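/- Let $d\in\mathbb{Q}^{*}$ be such that $16d$ is a $6$th-power-free integer (an integer not divisible by $m^6$ for any integer $m\ge 2$), and let $E^d: y^2=x^3+16d$. For $N\ge 1$ let $\mathbb{Q}(E^d[N])$ be the field generated over $\mathbb{Q}$ by the coordinates of all affine points of order dividing $N$ in $E^d(\mathbb{C})$. Then, for any choice of the complex square roots and cube roots, \[ \mathbb{Q}(E^d[3])=\mathbb{Q}(\sqrt d,\sqrt{-3},\sqrt[3]{d}),\qquad \mathbb{Q}(E^d[9])=\mathbb{Q}(\sqrt{-3},\sqrt[3]{3},\sqrt d,\sqrt[3]{d},\cos(2\pi/9)). \] Moreover, the degree of the $3$-division field is classified as follows: \begin{enumerate} \item $[\mathbb{Q}(E^d[3]):\mathbb{Q}]=2$ if and only if $d\in\{1,-27\}$; \item $[\mathbb{Q}(E^d[3]):\mathbb{Q}]=4$ if and only if $d=t^3$ for some $t\in\mathbb{Q}^{*}$ with $t\ne 1,-3$; \item $[\mathbb{Q}(E^d[3]):\mathbb{Q}]=6$ if and only if $d=t^2$ for some $t\in\mathbb{Q}^{*}$ with $t\ne\pm1$, or $d=-3t^2$ for some $t\in\mathbb{Q}^{*}$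 with $t\ne\pm3$; \item $[\mathbb{Q}(E^d[3]):\mathbb{Q}]=12$ if and only if $d$ is of none of the forms in (1)-(3); \end{enumerate} and the degree of the $9$-division field is classified as follows: \begin{enumerate} \item $[\mathbb{Q}(E^d[9]):\mathbb{Q}]=18$ if and only if $d\in\{1,-3,9,-27,81,-243\}$; \item $[\mathbb{Q}(E^d[9]):\mathbb{Q}]=36$ if and only if $d=t^3$ or $d=9t^3$ for some $t\in\mathbb{Q}^{*}$ with $t\ne 1,-3$, or $d=3t^3$ for some $t\in\mathbb{Q}^{*}$ with $t\ne -1,3$; \item $[\mathbb{Q}(E^d[9]):\mathbb{Q}]=54$ if and only if $d=t^2$ or $d=-3t^2$ for some $t\in\mathbb{Q}^{*}$ with $t\ne\pm1,\pm3,\pm9$; \item $[\mathbb{Q}(E^d[9]):\mathbb{Q}]=108$ if and only if $d$ is of none of the forms in (1)-(3). \end{enumerate} -/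

import Mathlib

/-- The curve `E^d : y² = x³ + 16 d` over `ℚ`. -/
def curveE (d : ℚ) : WeierstrassCurve ℚ where
  a₁ := 0
  a₂ := 0
  a₃ := 0
  a₄ := 0
  a₆ := 16 * d

/-- The division field `K(E[N])` inside an extension `L` of `K`: the field generated over `K` by
the affine coordinates of all points of `E(L)` killed by `N`. When `L` is algebraically closed
this involves all the `N`-torsion of `E`. -/
noncomputable def divisionField {K : Type*} [Field K] (E : WeierstrassCurve K) (N : ℕ)
    (L : Type*) [Field L] [DecidableEq L] [Algebra K L] : IntermediateField K L :=
  IntermediateField.adjoin K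
    {z : L | ∃ (x y : L) (h : (E.baseChange L).toAffine.Nonsingular x y),
      N • (WeierstrassCurve.Affine.Point.some x y h) = 0 ∧ (z = x ∨ z = y)}

/-- A rational number is `k`-th-power-free if it is an integer that is divisible by no `m ^ k`
with `m` an integer other than `1` and `-1`. -/
def IsPowerFree (k : ℕ) (q : ℚ) : Prop :=
  ∃ n : ℤ, (n : ℚ) = q ∧ ∀ m : ℤ, m ^ k ∣ n → m = 1 ∨ m = -1

/-!
Put `w = √-3`, `r = √d`, `s = ∛d`, write the points of `y² = x³ + 16 d` as `(x, 4 r z)`, and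
substitute `z = w (m - 1) / (m + 1)`, `x = -4 s n / (m + 1)`: this turns the curve into the Fermat
cubic `m³ + 1 = n³`. A complex multiplication by `√-3` sends a point with coordinate `m` to one with
`z = (m³ - 1) / (m³ + 1)`, so dividing by it means extracting a cube root, and its square is
multiplication by `-3`. Starting from the `3`-torsion, given by `z² = 1` or `z² = -3`, a
first division yields the primitive ninth roots of unity `m = ζ` and a second one
`m = (1 - ζ) (1 - ζ²) / ∛3`, for which `n` is again a monomial in `1 - ζ`, `1 - ζ²`, `1 - ζ⁴` and
`∛3`. Finally `ℚ(ζ) = ℚ(√-3, cos (2π/9))`.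

The degree of `ℚ(√d, √-3)` is prime to `3`, so by taking norms a rational number that becomes a cube
there is already a cube, and adjoining the cube roots is governed by Kummer theory. The exceptional
values of `d` are those with `d = a x² = b t³` for given `a` and `b`: this determines `d` up to
sixth powers, hence determines `d` when `16 d` is a sixth-power-free integer.
-/

section FermatCubic

variable {F : Type*} [Field F]

theorem isPrimitiveRoot_nine_iff [CharZero F] {ζ : F} :
    IsPrimitiveRoot ζ 9 ↔ ζ ^ 6 + ζ ^ 3 + 1 = 0 := by
  have cyclotomic_nine : Polynomial.cyclotomic 9 F =
      ∑ i ∈ Finset.range 3, (Polynomial.X ^ 3) ^ i :=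
    Polynomial.cyclotomic_prime_pow_eq_geom_sum (n := 1) Nat.prime_three
  rw [← Polynomial.isRoot_cyclotomic_iff, cyclotomic_nine, Polynomial.IsRoot]
  simp only [Finset.sum_range_succ, Finset.sum_range_zero, Polynomial.eval_add,
    Polynomial.eval_pow, Polynomial.eval_X, Polynomial.eval_zero]
  ring_nf

theorem one_add_two_mul_cube_sq [CharZero F] {ζ : F} (hζ : IsPrimitiveRoot ζ 9) :
    (1 + 2 * ζ ^ 3) ^ 2 = -3 := by
  linear_combination 4 * isPrimitiveRoot_nine_iff.1 hζ

/-- For `w² = -3`, the substitution `z = w (m - 1) / (m + 1)` turns the curve `x³ = b² (z² - 1)`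
into the Fermat cubic `m³ + 1 = n³`, where `x = -(4 b²)^(1/3) n / (m + 1)`. -/
def cayley (w m : F) : F :=
  w * (m - 1) / (m + 1)

theorem cayley_sq_sub_one {w m : F} (hw : w ^ 2 = -3) (hm : m + 1 ≠ 0) :
    cayley w m ^ 2 - 1 = -4 * (m ^ 3 + 1) / (m + 1) ^ 3 := by
  rw [cayley, div_pow, mul_pow, hw]
  field_simp
  ring

theorem cayley_sub_mul {w m : F} (hm : m + 1 ≠ 0) :
    (w - cayley w m) * m = w + cayley w m := by
  rw [cayley]
  field_simp
  ring

/-- The map `z ↦ z (z² - 9) / (3 w (z² - 1))` which, for `w² = -3`, complex multiplication by `-w`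
on the curve `y² = x³ + b²` induces on `z = y / b`. -/
def sqrtNegThreeMul (w z : F) : F :=
  z * (z ^ 2 - 9) / (3 * w * (z ^ 2 - 1))

theorem sqrtNegThreeMul_neg_left (w z : F) : sqrtNegThreeMul (-w) z = -sqrtNegThreeMul w z := by
  simp only [sqrtNegThreeMul, mul_neg, neg_mul, div_neg]

theorem sqrtNegThreeMul_neg_right (w z : F) : sqrtNegThreeMul w (-z) = -sqrtNegThreeMul w z := by
  simp only [sqrtNegThreeMul, neg_sq, neg_mul, neg_div]

variable [CharZero F]

theorem ne_zero_of_sq_eq_neg_three {w : F} (hw : w ^ 2 = -3) : w ≠ 0 := by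
  rintro rfl
  norm_num at hw

theorem exists_cayley_eq {w z : F} (hw : w ≠ 0) (hz : z ≠ w) : ∃ m, m + 1 ≠ 0 ∧ cayley w m = z := by
  have hz' : w - z ≠ 0 := sub_ne_zero.2 hz.symm
  have add_one : (w + z) / (w - z) + 1 = 2 * w / (w - z) := by
    field_simp
    ring
  refine ⟨(w + z) / (w - z), ?_, ?_⟩
  · rw [add_one]
    simp [hw, hz']
  · rw [cayley, add_one]
    field_simp
    ring

variable {w : F} (hw : w ^ 2 = -3)
include hw

theorem sqrtNegThreeMul_cayley (m : F) :
    sqrtNegThreeMul w (cayley w m) = (m ^ 3 - 1) / (m ^ 3 + 1) := by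
  have hw0 := ne_zero_of_sq_eq_neg_three hw
  rcases eq_or_ne (m + 1) 0 with hm | hm
  · have hm3 : m ^ 3 + 1 = 0 := by linear_combination (m ^ 2 - m + 1) * hm
    simp [sqrtNegThreeMul, cayley, hm, hm3]
  rcases eq_or_ne (m ^ 3 + 1) 0 with hm3 | hm3
  · simp [sqrtNegThreeMul, cayley_sq_sub_one hw hm, hm3]
  have sq_sub_nine : cayley w m ^ 2 - 9 = -12 * (m ^ 2 + m + 1) / (m + 1) ^ 2 := by
    rw [cayley, div_pow, mul_pow, hw]
    field_simp
    ring
  rw [sqrtNegThreeMul, cayley_sq_sub_one hw hm, sq_sub_nine, cayley]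
  field_simp
  ring

theorem sqrtNegThreeMul_sqrtNegThreeMul {z : F} (hz1 : z ^ 2 - 1 ≠ 0) (hz3 : z ^ 2 + 3 ≠ 0) :
    sqrtNegThreeMul w (sqrtNegThreeMul w z) =
      -(z * (z ^ 2 - 9) * (z ^ 2 * (z ^ 2 - 9) ^ 2 + 243 * (z ^ 2 - 1) ^ 2)) /
        (27 * (z ^ 2 - 1) * (z ^ 2 + 3) ^ 3) := by
  have hw0 := ne_zero_of_sq_eq_neg_three hw
  have sq_eq : sqrtNegThreeMul w z ^ 2 = -(z ^ 2 * (z ^ 2 - 9) ^ 2) / (27 * (z ^ 2 - 1) ^ 2) := by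
    rw [sqrtNegThreeMul, div_pow, mul_pow, mul_pow, mul_pow, hw]
    field_simp
    ring
  have sq_sub_one : sqrtNegThreeMul w z ^ 2 - 1 = -(z ^ 2 + 3) ^ 3 / (27 * (z ^ 2 - 1) ^ 2) := by
    rw [sq_eq]
    field_simp
    ring
  conv_lhs => rw [sqrtNegThreeMul, sq_sub_one, sq_eq, sqrtNegThreeMul]
  field_simp
  linear_combination 9 * z * (z ^ 2 - 9) * (z ^ 2 * (z ^ 2 - 9) ^ 2 + 243 * (z ^ 2 - 1) ^ 2) * hw

theorem sqrtNegThreeMul_sq_eq_one_iff {z : F} : sqrtNegThreeMul w z ^ 2 = 1 ↔ z ^ 2 = -3 := by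
  rcases eq_or_ne (z ^ 2 - 1) 0 with hz1 | hz1
  · rw [sqrtNegThreeMul, hz1, sub_eq_zero.1 hz1]
    norm_num
  · rw [sqrtNegThreeMul, div_pow, mul_pow _ (z ^ 2 - 1), mul_pow 3, hw,
      div_eq_one_iff_eq (by simp [hz1]), ← sub_eq_zero,
      show (z * (z ^ 2 - 9)) ^ 2 - 3 ^ 2 * -3 * (z ^ 2 - 1) ^ 2 = (z ^ 2 - -3) ^ 3 by ring,
      pow_eq_zero_iff three_ne_zero, sub_eq_zero]

theorem sqrtNegThreeMul_cayley_sq_eq_neg_three_iff (m : F) :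
    sqrtNegThreeMul w (cayley w m) ^ 2 = -3 ↔ IsPrimitiveRoot m 9 := by
  rw [sqrtNegThreeMul_cayley hw, isPrimitiveRoot_nine_iff]
  rcases eq_or_ne (m ^ 3 + 1) 0 with hm3 | hm3
  · simp [show m ^ 6 = 1 by linear_combination (m ^ 3 - 1) * hm3, eq_neg_iff_add_eq_zero.2 hm3]
  rw [div_pow, div_eq_iff (pow_ne_zero 2 hm3), ← sub_eq_zero,
    show (m ^ 3 - 1) ^ 2 - -3 * (m ^ 3 + 1) ^ 2 = 4 * (m ^ 6 + m ^ 3 + 1) by ring]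
  simp

omit hw

variable {ζ : F} (hζ : IsPrimitiveRoot ζ 9)
include hζ

theorem add_one_ne_zero_of_isPrimitiveRoot_nine : ζ + 1 ≠ 0 := by
  intro h
  have : (1 : F) = 0 := by
    linear_combination isPrimitiveRoot_nine_iff.1 hζ -
      (ζ ^ 5 - ζ ^ 4 + ζ ^ 3) * h
  exact one_ne_zero this

theorem sub_one_div_add_one_eq_cayley_iff {u : F} (hu : u + 1 ≠ 0) :
    (u - 1) / (u + 1) = cayley (1 + 2 * ζ ^ 3) ζ ↔ 3 * u = ((1 - ζ) * (1 - ζ ^ 2)) ^ 3 := by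
  have hΦ := isPrimitiveRoot_nine_iff.1 hζ
  have hζ1 := add_one_ne_zero_of_isPrimitiveRoot_nine hζ
  have unit_ne : 1 + ζ ^ 3 - ζ ^ 4 ≠ 0 := by
    intro h
    have : (1 : F) = 0 := by
      linear_combination (-1 + ζ ^ 2 - ζ ^ 3 - ζ ^ 4) * h + (2 - ζ ^ 2) * hΦ
    exact one_ne_zero this
  have cube_mul : ((1 - ζ) * (1 - ζ ^ 2)) ^ 3 * (1 + ζ ^ 3 - ζ ^ 4) = 3 * (ζ - ζ ^ 3 + ζ ^ 4) := by
    linear_combination (1 - 6 * ζ + 11 * ζ ^ 3 - 7 * ζ ^ 4 - 3 * ζ ^ 5 + 4 * ζ ^ 6 - ζ ^ 7) * hΦ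
  rw [cayley, div_eq_div_iff hu hζ1]
  constructor
  · intro hu'
    apply mul_right_cancel₀ unit_ne
    linear_combination (3 / 2) * hu' - cube_mul
  · intro hu'
    linear_combination (2 / 3) * (1 + ζ ^ 3 - ζ ^ 4) * hu' + (2 / 3) * cube_mul

/-- Divided by `9`, this says that `m = (1 - ζ) (1 - ζ²) / ∛3` and
`n = -(1 - ζ) (1 - ζ²)² (1 - ζ⁴) / ∛9` satisfy `n³ = m³ + 1`. -/
theorem fermat_identity :
    (-((1 - ζ) * (1 - ζ ^ 2) ^ 2 * (1 - ζ ^ 4))) ^ 3 = 3 * ((1 - ζ) * (1 - ζ ^ 2)) ^ 3 + 9 := by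
  have := isPrimitiveRoot_nine_iff.1 hζ
  grind

omit hζ
include hw

theorem exists_isPrimitiveRoot_of_sqrtNegThreeMul_eq {v : F} (hv : sqrtNegThreeMul w v = w) :
    ∃ p, IsPrimitiveRoot p 9 ∧ w = 1 + 2 * p ^ 3 ∧ cayley w p = v := by
  have hw0 := ne_zero_of_sq_eq_neg_three hw
  have hvw : v ≠ w := by
    rintro rfl
    have := (sqrtNegThreeMul_sq_eq_one_iff hw).2 hw
    rw [hv, hw] at this
    norm_num at this
  obtain ⟨p, -, rfl⟩ := exists_cayley_eq hw0 hvw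
  have hp : IsPrimitiveRoot p 9 := by
    rw [← sqrtNegThreeMul_cayley_sq_eq_neg_three_iff hw, hv, hw]
  rw [sqrtNegThreeMul_cayley hw] at hv
  have hp3 : p ^ 3 + 1 ≠ 0 := fun h => by simp [h, hw0.symm] at hv
  refine ⟨p, hp, mul_right_cancel₀ hp3 ?_, rfl⟩
  rw [← (div_eq_iff hp3).1 hv]
  linear_combination -2 * isPrimitiveRoot_nine_iff.1 hp

theorem exists_three_mul_cube_eq {z : F} (hz : sqrtNegThreeMul w (sqrtNegThreeMul w z) = w) :
    ∃ p m, IsPrimitiveRoot p 9 ∧ m + 1 ≠ 0 ∧ cayley w m = z ∧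
      3 * m ^ 3 = ((1 - p) * (1 - p ^ 2)) ^ 3 := by
  have hw0 := ne_zero_of_sq_eq_neg_three hw
  have mul_ne_zero_of_sq : ∀ v, v ^ 2 = 1 → sqrtNegThreeMul w v ≠ w := by
    intro v hv
    simpa [sqrtNegThreeMul, hv] using hw0.symm
  have hzw : z ≠ w := by
    rintro rfl
    exact mul_ne_zero_of_sq _ ((sqrtNegThreeMul_sq_eq_one_iff hw).2 hw) hz
  obtain ⟨m, hm, rfl⟩ := exists_cayley_eq hw0 hzw
  obtain ⟨p, hp, w_eq, hpm⟩ := exists_isPrimitiveRoot_of_sqrtNegThreeMul_eq hw hz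
  have hm3 : m ^ 3 + 1 ≠ 0 := by
    intro h
    rw [sqrtNegThreeMul_cayley hw, h, div_zero] at hz
    simp [sqrtNegThreeMul, hw0.symm] at hz
  refine ⟨p, m, hp, hm, rfl, ?_⟩
  rw [← sub_one_div_add_one_eq_cayley_iff hp hm3, ← w_eq, hpm, sqrtNegThreeMul_cayley hw]

end FermatCubic

section MordellCurve

open WeierstrassCurve.Affine

variable {F : Type*} [Field F]

/-- The Mordell curve `y² = x³ + k`. When `k = b²` with `b ≠ 0`, its points are written `(x, b z)`
below, so that the equation becomes `x³ = b² (z² - 1)`. -/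
def mordellCurve (k : F) : WeierstrassCurve F where
  a₁ := 0
  a₂ := 0
  a₃ := 0
  a₄ := 0
  a₆ := k

theorem mordellCurve_baseChange {L : Type*} [Field L] [Algebra F L] (k : F) :
    (mordellCurve k).baseChange L = mordellCurve (algebraMap F L k) := by
  ext <;> simp [mordellCurve]

theorem mordellCurve_equation_iff (k x y : F) :
    (mordellCurve k).toAffine.Equation x y ↔ y ^ 2 = x ^ 3 + k := by
  simp [mordellCurve, equation_iff]

theorem mordellCurve_negY (k x y : F) : (mordellCurve k).toAffine.negY x y = -y := by
  simp [mordellCurve, negY]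

theorem mordellCurve_addX (k x₁ x₂ ℓ : F) :
    (mordellCurve k).toAffine.addX x₁ x₂ ℓ = ℓ ^ 2 - x₁ - x₂ := by
  simp [mordellCurve, addX]

theorem mordellCurve_addY (k x₁ x₂ y ℓ : F) :
    (mordellCurve k).toAffine.addY x₁ x₂ y ℓ = ℓ * (x₁ - (ℓ ^ 2 - x₁ - x₂)) - y := by
  simp only [addY, negAddY, mordellCurve_negY, mordellCurve_addX]
  ring

theorem cube_eq_of_nonsingular {b x z : F}
    (h : (mordellCurve (b ^ 2)).toAffine.Nonsingular x (b * z)) :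
    x ^ 3 = b ^ 2 * (z ^ 2 - 1) := by
  linear_combination -(mordellCurve_equation_iff ..).1 h.1

theorem three_nsmul_some_zero [DecidableEq F] {k x : F}
    (h : (mordellCurve k).toAffine.Nonsingular x 0) :
    3 • Point.some x 0 h = Point.some x 0 h := by
  rw [succ_nsmul, two_nsmul, Point.add_self_of_Y_eq (by rw [mordellCurve_negY, neg_zero]),
    zero_add]

variable [CharZero F]

theorem mordellCurve_nonsingular {k x y : F} (h : y ^ 2 = x ^ 3 + k) (hy : y ≠ 0) :
    (mordellCurve k).toAffine.Nonsingular x y := by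
  refine (nonsingular_iff ..).2 ⟨(mordellCurve_equation_iff ..).2 h, .inr ?_⟩
  simpa [mordellCurve, self_eq_neg] using hy

variable {b x z : F}

theorem two_nsmul_x_sub (hz : z ≠ 0) :
    x * (z ^ 2 - 9) / (4 * z ^ 2) - x = -3 * x * (z ^ 2 + 3) / (4 * z ^ 2) := by
  field_simp
  ring

theorem two_nsmul_x_ne (hx : x ≠ 0) (hz : z ≠ 0) (hz3 : z ^ 2 + 3 ≠ 0) :
    x * (z ^ 2 - 9) / (4 * z ^ 2) ≠ x := by
  rw [← sub_ne_zero, two_nsmul_x_sub hz]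
  simp [hx, hz, hz3]

theorem addY_two_nsmul {w : F} (hw : w ^ 2 = -3) (h : x ^ 3 = b ^ 2 * (z ^ 2 - 1)) (hx : x ≠ 0)
    (hb : b ≠ 0) (hz : z ≠ 0) (hz1 : z ^ 2 - 1 ≠ 0) (hz3 : z ^ 2 + 3 ≠ 0) :
    (mordellCurve (b ^ 2)).toAffine.addY (x * (z ^ 2 - 9) / (4 * z ^ 2)) x
        (b * ((z ^ 4 + 18 * z ^ 2 - 27) / (8 * z ^ 3)))
        (b * (7 * z ^ 4 - 18 * z ^ 2 + 27) / (6 * x * z * (z ^ 2 + 3))) =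
      b * -sqrtNegThreeMul w (sqrtNegThreeMul w z) := by
  have slope_sq : (b * (7 * z ^ 4 - 18 * z ^ 2 + 27) / (6 * x * z * (z ^ 2 + 3))) ^ 2 =
      x * (7 * z ^ 4 - 18 * z ^ 2 + 27) ^ 2 / (36 * z ^ 2 * (z ^ 2 + 3) ^ 2 * (z ^ 2 - 1)) := by
    field_simp
    linear_combination -36 * (7 * z ^ 4 - 18 * z ^ 2 + 27) ^ 2 * h
  rw [mordellCurve_addY, slope_sq, sqrtNegThreeMul_sqrtNegThreeMul hw hz1 hz3]
  field_simp
  ring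

variable [DecidableEq F]

theorem exists_two_nsmul_eq_some (h : (mordellCurve (b ^ 2)).toAffine.Nonsingular x (b * z))
    (hb : b ≠ 0) (hz : z ≠ 0) :
    ∃ h', 2 • Point.some x (b * z) h =
      Point.some (x * (z ^ 2 - 9) / (4 * z ^ 2))
        (b * ((z ^ 4 + 18 * z ^ 2 - 27) / (8 * z ^ 3))) h' := by
  have hx := cube_eq_of_nonsingular h
  have hY : b * z ≠ (mordellCurve (b ^ 2)).toAffine.negY x (b * z) := by
    rw [mordellCurve_negY, Ne, self_eq_neg]
    exact mul_ne_zero hb hz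
  have slope_eq : (mordellCurve (b ^ 2)).toAffine.slope x x (b * z) (b * z) =
      3 * x ^ 2 / (2 * (b * z)) := by
    rw [slope_of_Y_ne rfl hY, mordellCurve_negY]
    simp only [mordellCurve]
    ring
  have x_eq : (3 * x ^ 2 / (2 * (b * z))) ^ 2 - x - x = x * (z ^ 2 - 9) / (4 * z ^ 2) := by
    field_simp
    linear_combination 36 * x * hx
  have y_eq : 3 * x ^ 2 / (2 * (b * z)) * (x - x * (z ^ 2 - 9) / (4 * z ^ 2)) - b * z =
      b * ((z ^ 4 + 18 * z ^ 2 - 27) / (8 * z ^ 3)) := by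
    field_simp
    linear_combination 72 * (z ^ 2 + 3) * hx
  have two_nsmul_eq := Point.add_self_of_Y_ne (h₁ := h) hY
  simp only [slope_eq, mordellCurve_addX, mordellCurve_addY, x_eq, y_eq] at two_nsmul_eq
  exact ⟨_, (two_nsmul _).trans two_nsmul_eq⟩

theorem three_nsmul_some_eq_zero_iff (h : (mordellCurve (b ^ 2)).toAffine.Nonsingular x (b * z))
    (hb : b ≠ 0) : 3 • Point.some x (b * z) h = 0 ↔ z ^ 2 = 1 ∨ z ^ 2 = -3 := by
  have hx := cube_eq_of_nonsingular h
  rcases eq_or_ne z 0 with rfl | hz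
  · simp only [mul_zero, three_nsmul_some_zero, Point.some_ne_zero]
    norm_num
  obtain ⟨h', two_nsmul_eq⟩ := exists_two_nsmul_eq_some h hb hz
  rw [succ_nsmul, add_eq_zero_iff_eq_neg, two_nsmul_eq, Point.neg_some, Point.some.injEq,
    mordellCurve_negY, div_eq_iff (by simp [hz]), mul_div_assoc', div_eq_iff (by simp [hz])]
  constructor
  · rintro ⟨-, hy⟩
    have factored : (z ^ 2 - 1) * (z ^ 2 - -3) = 0 := by
      apply mul_left_cancel₀ (mul_ne_zero (by norm_num : (9 : F) ≠ 0) hb)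
      linear_combination hy
    simpa only [mul_eq_zero, sub_eq_zero] using factored
  · rintro (hz1 | hz3)
    · have hx0 : x = 0 := by simpa [hz1] using hx
      exact ⟨by simp [hx0], by linear_combination 9 * b * (z ^ 2 + 3) * hz1⟩
    · exact ⟨by linear_combination -3 * x * hz3,
        by linear_combination 9 * b * (z ^ 2 - 1) * hz3⟩

theorem slope_two_nsmul (hx : x ≠ 0) (hz : z ≠ 0) (hz3 : z ^ 2 + 3 ≠ 0) :
    (mordellCurve (b ^ 2)).toAffine.slope (x * (z ^ 2 - 9) / (4 * z ^ 2)) x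
        (b * ((z ^ 4 + 18 * z ^ 2 - 27) / (8 * z ^ 3))) (b * z) =
      b * (7 * z ^ 4 - 18 * z ^ 2 + 27) / (6 * x * z * (z ^ 2 + 3)) := by
  rw [slope_of_X_ne (two_nsmul_x_ne hx hz hz3), two_nsmul_x_sub hz]
  field_simp
  ring

theorem exists_three_nsmul_eq_some {w : F} (hw : w ^ 2 = -3)
    (h : (mordellCurve (b ^ 2)).toAffine.Nonsingular x (b * z)) (hb : b ≠ 0)
    (hz1 : z ^ 2 ≠ 1) (hz3 : z ^ 2 ≠ -3) :
    ∃ X h', 3 • Point.some x (b * z) h =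
      Point.some X (b * -sqrtNegThreeMul w (sqrtNegThreeMul w z)) h' := by
  have hx := cube_eq_of_nonsingular h
  rcases eq_or_ne z 0 with rfl | hz
  · simp only [mul_zero, three_nsmul_some_zero]
    have : b * -sqrtNegThreeMul w (sqrtNegThreeMul w 0) = 0 := by simp [sqrtNegThreeMul]
    simp only [this]
    exact ⟨x, by simpa using h, rfl⟩
  obtain ⟨h', two_nsmul_eq⟩ := exists_two_nsmul_eq_some h hb hz
  replace hz1 : z ^ 2 - 1 ≠ 0 := sub_ne_zero.2 hz1
  replace hz3 : z ^ 2 + 3 ≠ 0 := by rwa [← sub_neg_eq_add, sub_ne_zero]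
  have hx0 : x ≠ 0 := by
    rintro rfl
    simp [hb, hz1] at hx
  have three_nsmul_eq := Point.add_of_X_ne (h₁ := h') (h₂ := h) (two_nsmul_x_ne hx0 hz hz3)
  simp only [slope_two_nsmul hx0 hz hz3, addY_two_nsmul hw hx hx0 hb hz hz1 hz3]
    at three_nsmul_eq
  rw [succ_nsmul, two_nsmul_eq]
  exact ⟨_, _, three_nsmul_eq⟩

theorem nine_nsmul_some_eq_zero_iff {w : F} (hw : w ^ 2 = -3)
    (h : (mordellCurve (b ^ 2)).toAffine.Nonsingular x (b * z)) (hb : b ≠ 0) :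
    9 • Point.some x (b * z) h = 0 ↔ (z ^ 2 = 1 ∨ z ^ 2 = -3) ∨
      (sqrtNegThreeMul w (sqrtNegThreeMul w z) ^ 2 = 1 ∨
        sqrtNegThreeMul w (sqrtNegThreeMul w z) ^ 2 = -3) := by
  rw [show 9 = 3 * 3 from rfl, mul_nsmul]
  by_cases hz : z ^ 2 = 1 ∨ z ^ 2 = -3
  · simp only [(three_nsmul_some_eq_zero_iff h hb).2 hz, smul_zero, hz, true_or]
  · obtain ⟨hz1, hz3⟩ := not_or.1 hz
    obtain ⟨X, h', three_nsmul_eq⟩ := exists_three_nsmul_eq_some hw h hb hz1 hz3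
    rw [three_nsmul_eq, three_nsmul_some_eq_zero_iff h' hb, neg_sq]
    simp only [hz, false_or]

end MordellCurve

section DivisionField

open WeierstrassCurve.Affine

variable {K L : Type*} [Field K] [Field L] [Algebra K L]

theorem mem_of_pow_eq_pow {M : IntermediateField K L} {n : ℕ} [NeZero n] {ω a b : L}
    (hω : IsPrimitiveRoot ω n) (hωM : ω ∈ M) (hb : b ∈ M) (hab : a ^ n = b ^ n) : a ∈ M := by
  rcases eq_or_ne b 0 with rfl | hb0
  · rw [zero_pow (NeZero.ne n), pow_eq_zero_iff (NeZero.ne n)] at hab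
    rwa [hab]
  · obtain ⟨i, -, hi⟩ := hω.eq_pow_of_pow_eq_one (ξ := a / b) (by
      rw [div_pow, hab, div_self (pow_ne_zero n hb0)])
    rw [← div_mul_cancel₀ a hb0, ← hi]
    exact mul_mem (pow_mem hωM i) hb

theorem isPrimitiveRoot_three_of_sq_eq_neg_three [CharZero L] {w : L} (hw : w ^ 2 = -3) :
    IsPrimitiveRoot ((w - 1) / 2) 3 := by
  rw [← Polynomial.isRoot_cyclotomic_iff, Polynomial.cyclotomic_three, Polynomial.IsRoot]
  simp only [Polynomial.eval_add, Polynomial.eval_pow, Polynomial.eval_X, Polynomial.eval_one]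
  linear_combination hw / 4

theorem mem_of_cube_eq_cube [CharZero L] {M : IntermediateField K L} {w a b : L} (hw : w ^ 2 = -3)
    (hwM : w ∈ M) (hb : b ∈ M) (hab : a ^ 3 = b ^ 3) : a ∈ M :=
  mem_of_pow_eq_pow (isPrimitiveRoot_three_of_sq_eq_neg_three hw)
    (div_mem (sub_mem hwM (one_mem M)) (ofNat_mem M 2)) hb hab

theorem one_add_two_mul_mem_iff [CharZero L] {M : IntermediateField K L} {a : L} :
    1 + 2 * a ∈ M ↔ a ∈ M := by
  refine ⟨fun h => ?_, fun h => add_mem (one_mem M) (mul_mem (ofNat_mem M 2) h)⟩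
  rw [show a = (1 + 2 * a - 1) / 2 by ring]
  exact div_mem (sub_mem h (one_mem M)) (ofNat_mem M 2)

theorem mem_of_sq_eq_sq {M : IntermediateField K L} {a b : L} (hb : b ∈ M) (hab : a ^ 2 = b ^ 2) :
    a ∈ M := by
  rcases sq_eq_sq_iff_eq_or_eq_neg.1 hab with rfl | rfl
  exacts [hb, neg_mem hb]

theorem fermat_cube {r s w m n : L} (hrs : r ^ 2 = s ^ 3) (hw : w ^ 2 = -3) (hm : m + 1 ≠ 0)
    (hmn : n ^ 3 = m ^ 3 + 1) :
    (-4 * s * n / (m + 1)) ^ 3 = (4 * r) ^ 2 * (cayley w m ^ 2 - 1) := by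
  rw [cayley_sq_sub_one hw hm, mul_pow, hrs, div_pow, mul_pow, hmn]
  ring

theorem algebraMap_sixteen_mul {d : K} {r : L} (hr : r ^ 2 = algebraMap K L d) :
    algebraMap K L (16 * d) = (4 * r) ^ 2 := by
  rw [map_mul, map_ofNat, ← hr]
  ring

variable [DecidableEq L]

theorem divisionField_le_iff {E : WeierstrassCurve K} {N : ℕ} {M : IntermediateField K L} :
    divisionField E N L ≤ M ↔ ∀ x y (h : (E.baseChange L).toAffine.Nonsingular x y),
      N • Point.some x y h = 0 → x ∈ M ∧ y ∈ M := by
  rw [divisionField, IntermediateField.adjoin_le_iff]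
  constructor
  · exact fun hM x y h hN => ⟨hM ⟨x, y, h, hN, .inl rfl⟩, hM ⟨x, y, h, hN, .inr rfl⟩⟩
  · rintro hM z ⟨x, y, h, hN, rfl | rfl⟩
    exacts [(hM _ _ h hN).1, (hM _ _ h hN).2]

theorem divisionField_mono_of_dvd (E : WeierstrassCurve K) {M N : ℕ} (hMN : M ∣ N) :
    divisionField E M L ≤ divisionField E N L := by
  refine divisionField_le_iff.2 fun x y h hM => divisionField_le_iff.1 le_rfl x y h ?_
  obtain ⟨k, rfl⟩ := hMN
  rw [mul_nsmul, hM, smul_zero]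

theorem divisionField_mordellCurve_le_iff {k : K} {b : L} (hk : algebraMap K L k = b ^ 2)
    (hb : b ≠ 0) {N : ℕ} {M : IntermediateField K L} :
    divisionField (mordellCurve k) N L ≤ M ↔
      ∀ x z (h : (mordellCurve (b ^ 2)).toAffine.Nonsingular x (b * z)),
        N • Point.some x (b * z) h = 0 → x ∈ M ∧ b * z ∈ M := by
  rw [divisionField_le_iff, mordellCurve_baseChange, hk]
  refine ⟨fun hM x z => hM x (b * z), fun hM x y => ?_⟩
  rw [← mul_div_cancel₀ y hb]
  exact hM x (y / b)

end DivisionField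

section Coordinates

variable {K L : Type*} [Field K] [Field L] [Algebra K L] [CharZero L] {M : IntermediateField K L}
  {r s w x z : L} (hrs : r ^ 2 = s ^ 3) (hw : w ^ 2 = -3) (hsM : s ∈ M) (hwM : w ∈ M)
  (hx : x ^ 3 = (4 * r) ^ 2 * (z ^ 2 - 1))
include hrs hw hsM hwM hx

theorem mem_of_sq_eq_one_or_neg_three (hz : z ^ 2 = 1 ∨ z ^ 2 = -3) : x ∈ M ∧ z ∈ M := by
  rcases hz with hz | hz <;> rw [hz] at hx
  · exact ⟨mem_of_cube_eq_cube hw hwM (zero_mem M) (by rw [hx]; ring),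
      mem_of_sq_eq_sq (one_mem M) (by rw [hz, one_pow])⟩
  · refine ⟨mem_of_cube_eq_cube hw hwM (mul_mem (neg_mem (ofNat_mem M 4)) hsM) ?_,
      mem_of_sq_eq_sq hwM (by rw [hz, hw])⟩
    linear_combination hx - 64 * hrs

theorem mem_of_eq_cayley {m n : L} (hm : m + 1 ≠ 0) (hmn : n ^ 3 = m ^ 3 + 1) (hmM : m ∈ M)
    (hnM : n ∈ M) (hz : cayley w m = z) : x ∈ M ∧ z ∈ M := by
  subst hz
  have hm1 : m + 1 ∈ M := add_mem hmM (one_mem M)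
  refine ⟨mem_of_cube_eq_cube hw hwM
    (div_mem (mul_mem (mul_mem (neg_mem (ofNat_mem M 4)) hsM) hnM) hm1)
    (hx.trans (fermat_cube hrs hw hm hmn).symm), ?_⟩
  exact div_mem (mul_mem hwM (sub_mem hmM (one_mem M))) hm1

variable {ζ : L} (hζ : IsPrimitiveRoot ζ 9) (hζM : ζ ∈ M)
include hζ hζM

theorem mem_of_sqrtNegThreeMul_sq (hz : sqrtNegThreeMul w z ^ 2 = -3) : x ∈ M ∧ z ∈ M := by
  have hzw : z ≠ w := by
    rintro rfl
    rw [(sqrtNegThreeMul_sq_eq_one_iff hw).2 hw] at hz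
    norm_num at hz
  obtain ⟨m, hm, rfl⟩ := exists_cayley_eq (ne_zero_of_sq_eq_neg_three hw) hzw
  have hm9 : IsPrimitiveRoot m 9 := (sqrtNegThreeMul_cayley_sq_eq_neg_three_iff hw m).1 hz
  have hmM : m ∈ M := mem_of_pow_eq_pow hζ hζM (one_mem M) (by rw [hm9.pow_eq_one, one_pow])
  refine mem_of_eq_cayley hrs hw hsM hwM hx hm (n := -m ^ 2) ?_ hmM (neg_mem (pow_mem hmM 2)) rfl
  linear_combination -isPrimitiveRoot_nine_iff.1 hm9

variable {c : L} (hc : c ^ 3 = 3) (hcM : c ∈ M)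
include hc hcM

theorem mem_of_sqrtNegThreeMul_sqrtNegThreeMul_eq
    (hz : sqrtNegThreeMul w (sqrtNegThreeMul w z) = w) : x ∈ M ∧ z ∈ M := by
  obtain ⟨p, m, hp, hm, hmz, hm3⟩ := exists_three_mul_cube_eq hw hz
  have hpM : p ∈ M := mem_of_pow_eq_pow hζ hζM (one_mem M) (by rw [hp.pow_eq_one, one_pow])
  have one_sub_mem (k : ℕ) : 1 - p ^ k ∈ M := sub_mem (one_mem M) (pow_mem hpM k)
  have hmM : m ∈ M := by
    refine mem_of_cube_eq_cube hw hwM (b := (1 - p ^ 1) * (1 - p ^ 2) / c)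
      (div_mem (mul_mem (one_sub_mem 1) (one_sub_mem 2)) hcM) ?_
    rw [div_pow, hc, pow_one, ← hm3, mul_div_cancel_left₀ _ three_ne_zero]
  refine mem_of_eq_cayley hrs hw hsM hwM hx hm
    (n := -((1 - p ^ 1) * (1 - p ^ 2) ^ 2 * (1 - p ^ 4)) / c ^ 2) ?_ hmM ?_ hmz
  · rw [div_pow, pow_one, fermat_identity hp, ← hm3, pow_right_comm, hc]
    ring
  · exact div_mem (neg_mem (mul_mem (mul_mem (one_sub_mem 1) (pow_mem (one_sub_mem 2) 2))
      (one_sub_mem 4))) (pow_mem hcM 2)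

theorem mem_of_sqrtNegThreeMul_sqrtNegThreeMul_sq
    (hz : sqrtNegThreeMul w (sqrtNegThreeMul w z) ^ 2 = -3) : x ∈ M ∧ z ∈ M := by
  rcases sq_eq_sq_iff_eq_or_eq_neg.1 (hz.trans hw.symm) with hz | hz
  · exact mem_of_sqrtNegThreeMul_sqrtNegThreeMul_eq hrs hw hsM hwM hx hζ hζM hc hcM hz
  · refine mem_of_sqrtNegThreeMul_sqrtNegThreeMul_eq hrs (w := -w) (by rw [neg_sq, hw]) hsM
      (neg_mem hwM) hx hζ hζM hc hcM ?_
    rw [sqrtNegThreeMul_neg_left, sqrtNegThreeMul_neg_left, sqrtNegThreeMul_neg_right, neg_neg, hz]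

end Coordinates

section DivisionFieldGenerators

variable {K L : Type*} [Field K] [Field L] [Algebra K L] [CharZero L] {d : K} {r s w : L}

theorem four_mul_ne_zero_of_sq_eq_algebraMap (hd : d ≠ 0) (hr : r ^ 2 = algebraMap K L d) :
    4 * r ≠ 0 := by
  refine mul_ne_zero (by norm_num) fun hr0 => hd ((map_eq_zero (algebraMap K L)).1 ?_)
  rw [← hr, hr0, zero_pow two_ne_zero]

variable [DecidableEq L]

theorem mem_divisionField_three {k : K} {b x z : L} (hk : algebraMap K L k = b ^ 2) (hb : b ≠ 0)
    (hx : x ^ 3 = b ^ 2 * (z ^ 2 - 1)) (hz : z ^ 2 = 1 ∨ z ^ 2 = -3) :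
    x ∈ divisionField (mordellCurve k) 3 L ∧ b * z ∈ divisionField (mordellCurve k) 3 L := by
  have hz0 : z ≠ 0 := by
    rintro rfl
    norm_num at hz
  have h : (mordellCurve (b ^ 2)).toAffine.Nonsingular x (b * z) :=
    mordellCurve_nonsingular (by linear_combination -hx) (mul_ne_zero hb hz0)
  exact (divisionField_mordellCurve_le_iff hk hb).1 le_rfl x z h
    ((three_nsmul_some_eq_zero_iff h hb).2 hz)

theorem mem_divisionField_nine {k : K} {b x z : L} (hk : algebraMap K L k = b ^ 2) (hb : b ≠ 0)
    (hx : x ^ 3 = b ^ 2 * (z ^ 2 - 1)) (hw : w ^ 2 = -3)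
    (hz : sqrtNegThreeMul w (sqrtNegThreeMul w z) ^ 2 = 1 ∨
      sqrtNegThreeMul w (sqrtNegThreeMul w z) ^ 2 = -3) :
    x ∈ divisionField (mordellCurve k) 9 L ∧ b * z ∈ divisionField (mordellCurve k) 9 L := by
  have hz0 : z ≠ 0 := by
    rintro rfl
    norm_num [sqrtNegThreeMul] at hz
  have h : (mordellCurve (b ^ 2)).toAffine.Nonsingular x (b * z) :=
    mordellCurve_nonsingular (by linear_combination -hx) (mul_ne_zero hb hz0)
  exact (divisionField_mordellCurve_le_iff hk hb).1 le_rfl x z h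
    ((nine_nsmul_some_eq_zero_iff hw h hb).2 (.inr hz))

variable (hd : d ≠ 0) (hr : r ^ 2 = algebraMap K L d)
include hd hr

theorem mem_divisionField_nine_of_cayley {m n : L} (hs : s ^ 3 = algebraMap K L d)
    (hw : w ^ 2 = -3) (hrD : r ∈ divisionField (mordellCurve (16 * d)) 9 L)
    (hwD : w ∈ divisionField (mordellCurve (16 * d)) 9 L)
    (hm : m + 1 ≠ 0) (hmn : n ^ 3 = m ^ 3 + 1)
    (hz : sqrtNegThreeMul w (sqrtNegThreeMul w (cayley w m)) ^ 2 = 1 ∨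
      sqrtNegThreeMul w (sqrtNegThreeMul w (cayley w m)) ^ 2 = -3) :
    m ∈ divisionField (mordellCurve (16 * d)) 9 L := by
  have hb := four_mul_ne_zero_of_sq_eq_algebraMap hd hr
  have hcD : cayley w m ∈ divisionField (mordellCurve (16 * d)) 9 L := by
    rw [← mul_div_cancel_left₀ (cayley w m) hb]
    exact div_mem (mem_divisionField_nine (algebraMap_sixteen_mul hr) hb
      (fermat_cube (hr.trans hs.symm) hw hm hmn) hw hz).2 (mul_mem (ofNat_mem _ 4) hrD)
  have sub_ne_zero : w - cayley w m ≠ 0 := by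
    intro h
    have h' := cayley_sub_mul (w := w) hm
    rw [h, zero_mul, ← sub_eq_zero.1 h, eq_comm, add_self_eq_zero] at h'
    exact ne_zero_of_sq_eq_neg_three hw h'
  rw [eq_div_of_mul_eq sub_ne_zero ((mul_comm ..).trans (cayley_sub_mul hm))]
  exact div_mem (add_mem hwD hcD) (sub_mem hwD hcD)

theorem divisionField_three_eq_adjoin (hs : s ^ 3 = algebraMap K L d) (hw : w ^ 2 = -3) :
    divisionField (mordellCurve (16 * d)) 3 L = IntermediateField.adjoin K {r, w, s} := by
  have hk := algebraMap_sixteen_mul hr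
  have hb := four_mul_ne_zero_of_sq_eq_algebraMap hd hr
  apply le_antisymm
  · have mem_adjoin {a : L} (ha : a ∈ ({r, w, s} : Set L)) :=
      IntermediateField.subset_adjoin K _ ha
    refine (divisionField_mordellCurve_le_iff hk hb).2 fun x z h h3 => ?_
    obtain ⟨hxM, hzM⟩ := mem_of_sq_eq_one_or_neg_three (hr.trans hs.symm) hw
      (mem_adjoin (by simp)) (mem_adjoin (by simp)) (cube_eq_of_nonsingular h)
      ((three_nsmul_some_eq_zero_iff h hb).1 h3)
    exact ⟨hxM, mul_mem (mul_mem (ofNat_mem _ 4) (mem_adjoin (by simp))) hzM⟩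
  · have four_ne : (4 : L) ≠ 0 := by norm_num
    have hbD : 4 * r ∈ divisionField (mordellCurve (16 * d)) 3 L := by
      simpa using (mem_divisionField_three hk hb (x := 0) (z := 1) (by ring) (by simp)).2
    obtain ⟨hsD, hwD⟩ := mem_divisionField_three hk hb (x := -4 * s) (z := w)
      (by linear_combination 64 * (hr.trans hs.symm) - 16 * r ^ 2 * hw) (.inr hw)
    rw [IntermediateField.adjoin_le_iff]
    rintro a (rfl | rfl | rfl)
    · exact mul_div_cancel_left₀ a four_ne ▸ div_mem hbD (ofNat_mem _ 4)
    · exact mul_div_cancel_left₀ a hb ▸ div_mem hwD hbD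
    · exact mul_div_cancel_left₀ a (neg_ne_zero.2 four_ne) ▸
        div_mem hsD (neg_mem (ofNat_mem _ 4))

variable {ζ c : L} (hs : s ^ 3 = algebraMap K L d) (hζ : IsPrimitiveRoot ζ 9) (hc : c ^ 3 = 3)
include hs hζ

theorem mem_divisionField_nine_of_isPrimitiveRoot :
    r ∈ divisionField (mordellCurve (16 * d)) 9 L ∧
      s ∈ divisionField (mordellCurve (16 * d)) 9 L ∧
      ζ ∈ divisionField (mordellCurve (16 * d)) 9 L := by
  have hw := one_add_two_mul_cube_sq hζ
  have mem_nine {a : L} (ha : a ∈ ({r, 1 + 2 * ζ ^ 3, s} : Set L)) :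
      a ∈ divisionField (mordellCurve (16 * d)) 9 L :=
    divisionField_mono_of_dvd _ (by norm_num)
      (divisionField_three_eq_adjoin hd hr hs hw ▸ IntermediateField.subset_adjoin K _ ha)
  refine ⟨mem_nine (by simp), mem_nine (by simp),
    mem_divisionField_nine_of_cayley hd hr hs hw (mem_nine (by simp)) (mem_nine (by simp))
      (add_one_ne_zero_of_isPrimitiveRoot_nine hζ) (n := -ζ ^ 2) ?_ (.inl ?_)⟩
  · linear_combination -isPrimitiveRoot_nine_iff.1 hζ
  · rwa [sqrtNegThreeMul_sq_eq_one_iff hw, sqrtNegThreeMul_cayley_sq_eq_neg_three_iff hw]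

include hc

theorem mem_divisionField_nine_of_cube_eq_three :
    c ∈ divisionField (mordellCurve (16 * d)) 9 L := by
  obtain ⟨hrD, -, hζD⟩ := mem_divisionField_nine_of_isPrimitiveRoot hd hr hs hζ
  have hw := one_add_two_mul_cube_sq hζ
  have hwD : 1 + 2 * ζ ^ 3 ∈ divisionField (mordellCurve (16 * d)) 9 L :=
    one_add_two_mul_mem_iff.2 (pow_mem hζD 3)
  have hc0 : c ≠ 0 := by
    rintro rfl
    norm_num at hc
  have one_sub_ne_zero (k : ℕ) (hk : ¬ 9 ∣ k) : 1 - ζ ^ k ≠ 0 :=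
    sub_ne_zero.2 fun h => hk (hζ.dvd_of_pow_eq_one k h.symm)
  have h1 : 1 - ζ ≠ 0 := by simpa using one_sub_ne_zero 1 (by norm_num)
  have h2 : 1 - ζ ^ 2 ≠ 0 := one_sub_ne_zero 2 (by norm_num)
  have h4 : 1 - ζ ^ 4 ≠ 0 := one_sub_ne_zero 4 (by norm_num)
  set m := (1 - ζ) * (1 - ζ ^ 2) / c with hm_def
  set n := -((1 - ζ) * (1 - ζ ^ 2) ^ 2 * (1 - ζ ^ 4)) / c ^ 2 with hn_def
  have hn0 : n ≠ 0 := by simp [hn_def, h1, h2, h4, hc0]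
  have hm3 : 3 * m ^ 3 = ((1 - ζ) * (1 - ζ ^ 2)) ^ 3 := by
    rw [hm_def, div_pow, hc, mul_div_cancel₀ _ three_ne_zero]
  have hmn : n ^ 3 = m ^ 3 + 1 := by
    rw [hn_def, div_pow, fermat_identity hζ, ← hm3, pow_right_comm, hc]
    ring
  have hm31 : m ^ 3 + 1 ≠ 0 := hmn ▸ pow_ne_zero 3 hn0
  have hm1 : m + 1 ≠ 0 := fun h => hm31 (by linear_combination (m ^ 2 - m + 1) * h)
  have hmD := mem_divisionField_nine_of_cayley hd hr hs hw hrD hwD hm1 hmn <| .inr <| by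
    rwa [sqrtNegThreeMul_cayley hw, (sub_one_div_add_one_eq_cayley_iff hζ hm31).2 hm3,
      sqrtNegThreeMul_cayley_sq_eq_neg_three_iff hw]
  have hc_eq : (1 - ζ) * (1 - ζ ^ 2) / m = c := by
    rw [hm_def, div_div_cancel₀ (mul_ne_zero h1 h2)]
  rw [← hc_eq]
  exact div_mem (mul_mem (sub_mem (one_mem _) hζD) (sub_mem (one_mem _) (pow_mem hζD 2))) hmD

theorem divisionField_nine_eq_adjoin :
    divisionField (mordellCurve (16 * d)) 9 L = IntermediateField.adjoin K {ζ, c, r, s} := by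
  have hb := four_mul_ne_zero_of_sq_eq_algebraMap hd hr
  have hw := one_add_two_mul_cube_sq hζ
  have hrs := hr.trans hs.symm
  apply le_antisymm
  · have mem_adjoin {a : L} (ha : a ∈ ({ζ, c, r, s} : Set L)) :=
      IntermediateField.subset_adjoin K _ ha
    have hζM := mem_adjoin (a := ζ) (by simp)
    have hcM := mem_adjoin (a := c) (by simp)
    have hsM := mem_adjoin (a := s) (by simp)
    have hwM := one_add_two_mul_mem_iff.2 (pow_mem hζM 3)
    refine (divisionField_mordellCurve_le_iff (algebraMap_sixteen_mul hr) hb).2 fun x z h h9 => ?_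
    suffices hxz : x ∈ IntermediateField.adjoin K {ζ, c, r, s} ∧
        z ∈ IntermediateField.adjoin K {ζ, c, r, s} from
      ⟨hxz.1, mul_mem (mul_mem (ofNat_mem _ 4) (mem_adjoin (by simp))) hxz.2⟩
    have hx := cube_eq_of_nonsingular h
    rcases (nine_nsmul_some_eq_zero_iff hw h hb).1 h9 with hz | hz | hz
    · exact mem_of_sq_eq_one_or_neg_three hrs hw hsM hwM hx hz
    · exact mem_of_sqrtNegThreeMul_sq hrs hw hsM hwM hx hζ hζM
        ((sqrtNegThreeMul_sq_eq_one_iff hw).1 hz)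
    · exact mem_of_sqrtNegThreeMul_sqrtNegThreeMul_sq hrs hw hsM hwM hx hζ hζM hc hcM hz
  · obtain ⟨hrD, hsD, hζD⟩ := mem_divisionField_nine_of_isPrimitiveRoot hd hr hs hζ
    rw [IntermediateField.adjoin_le_iff]
    rintro a (rfl | rfl | rfl | rfl)
    exacts [hζD, mem_divisionField_nine_of_cube_eq_three hd hr hs hζ hc, hrD, hsD]

end DivisionFieldGenerators

section CosineGenerator

theorem adjoin_sqrt_neg_three_cos_eq {K L : Type*} [Field K] [Field L] [Algebra K L] [CharZero L]
    {w ζ a : L} (hw : w ^ 2 = -3) (hζ : IsPrimitiveRoot ζ 9) (ha : 2 * a = ζ + ζ⁻¹) :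
    IntermediateField.adjoin K {w, a} = IntermediateField.adjoin K {ζ} := by
  have hwζ := one_add_two_mul_cube_sq hζ
  have hζ0 : ζ ≠ 0 := hζ.ne_zero (by norm_num)
  apply le_antisymm <;> rw [IntermediateField.adjoin_le_iff]
  · have hζM := IntermediateField.mem_adjoin_simple_self K ζ
    rintro b (rfl | rfl)
    · exact mem_of_sq_eq_sq (one_add_two_mul_mem_iff.2 (pow_mem hζM 3)) (hw.trans hwζ.symm)
    · rw [← mul_div_cancel_left₀ b (two_ne_zero (α := L)), ha]
      exact div_mem (add_mem hζM (inv_mem hζM)) (ofNat_mem _ 2)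
  · have hwM : w ∈ IntermediateField.adjoin K {w, a} :=
      IntermediateField.subset_adjoin K _ (by simp)
    have haM : 2 * a ∈ IntermediateField.adjoin K {w, a} :=
      mul_mem (ofNat_mem _ 2) (IntermediateField.subset_adjoin K _ (by simp))
    have hwζM : 1 + 2 * ζ ^ 3 ∈ IntermediateField.adjoin K {w, a} :=
      mem_of_sq_eq_sq hwM (hwζ.trans hw.symm)
    have hωM : ζ ^ 3 ∈ IntermediateField.adjoin K {w, a} := one_add_two_mul_mem_iff.1 hwζM
    -- `A := ζ + ζ⁻¹` has `A⁴ - 4 A² + 2 = ζ⁴ + ζ⁻⁴ = ζ³ ζ + ζ⁶ ζ⁻¹`; subtracting `ζ⁶ A` leaves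
    -- `(ζ³ - ζ⁶) ζ`.
    have ζ_eq : ζ = ((2 * a) ^ 4 - 4 * (2 * a) ^ 2 + 2 - (ζ ^ 3) ^ 2 * (2 * a)) /
        (1 + 2 * ζ ^ 3) := by
      rw [eq_div_iff (ne_zero_of_sq_eq_neg_three hwζ), ha]
      field_simp
      linear_combination (ζ ^ 5 + ζ ^ 3 - 1) * isPrimitiveRoot_nine_iff.1 hζ
    rintro _ rfl
    rw [SetLike.mem_coe, ζ_eq]
    exact div_mem (sub_mem (add_mem (sub_mem (pow_mem haM 4) (mul_mem (ofNat_mem _ 4)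
      (pow_mem haM 2))) (ofNat_mem _ 2)) (mul_mem (pow_mem hωM 2) haM)) hwζM

theorem divisionField_nine_eq_adjoin_sqrt_neg_three_cos {K L : Type*} [Field K] [Field L]
    [Algebra K L] [CharZero L] [DecidableEq L] {d : K} {r s w c ζ a : L} (hd : d ≠ 0)
    (hr : r ^ 2 = algebraMap K L d) (hs : s ^ 3 = algebraMap K L d) (hw : w ^ 2 = -3)
    (hc : c ^ 3 = 3) (hζ : IsPrimitiveRoot ζ 9) (ha : 2 * a = ζ + ζ⁻¹) :
    divisionField (mordellCurve (16 * d)) 9 L = IntermediateField.adjoin K {w, c, r, s, a} := by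
  rw [divisionField_nine_eq_adjoin hd hr hs hζ hc,
    show ({w, c, r, s, a} : Set L) = {w, a} ∪ {c, r, s} by grind, IntermediateField.adjoin_union,
    adjoin_sqrt_neg_three_cos_eq hw hζ ha, ← IntermediateField.adjoin_union, ← Set.insert_eq]

theorem two_mul_cos_eq_exp_add_inv :
    2 * ((Real.cos (2 * Real.pi / 9) : ℝ) : ℂ) =
      Complex.exp (2 * Real.pi * Complex.I / (9 : ℕ)) +
        (Complex.exp (2 * Real.pi * Complex.I / (9 : ℕ)))⁻¹ := by
  rw [Complex.ofReal_cos, Complex.two_cos, ← Complex.exp_neg]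
  push_cast
  ring_nf

end CosineGenerator

section Kummer

open IntermediateField Module Polynomial

theorem exists_eq_algebraMap_mul_pow_of_pow_eq {K L : Type*} [Field K] [Field L] [Algebra K L]
    {n : ℕ} [NeZero n] {ω a g : K} {α γ : L} (hω : IsPrimitiveRoot ω n)
    (ha : Irreducible (X ^ n - C a)) [IsSplittingField K L (X ^ n - C a)] (hα0 : α ≠ 0)
    (hα : α ^ n = algebraMap K L a) (hγ : γ ^ n = algebraMap K L g) :
    ∃ i < n, ∃ f : K, γ = algebraMap K L f * α ^ i := by
  rcases eq_or_ne γ 0 with rfl | hγ0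
  · exact ⟨0, NeZero.pos n, 0, by simp⟩
  have := IsSplittingField.finiteDimensional L (X ^ n - C a)
  have := isGalois_of_isSplittingField_X_pow_sub_C
    ⟨ω, (mem_primitiveRoots (NeZero.pos n)).2 hω⟩ ha L
  let e := (autEquivZmod ha L hω).symm
  let σ := e (Multiplicative.ofAdd 1)
  have σ_α : σ α = algebraMap K L ω * α := by
    simpa [Algebra.smul_def] using autEquivZmod_symm_apply_natCast ha L hα hω 1
  obtain ⟨i, hi, σ_γ⟩ := (hω.map_of_injective (algebraMap K L).injective).eq_pow_of_pow_eq_one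
    (ξ := σ γ / γ) (by
      rw [div_pow, ← map_pow, hγ, AlgEquiv.commutes, ← hγ, div_self (pow_ne_zero n hγ0)])
  have σ_fix : σ ∈ MulAction.stabilizer Gal(L/K) (γ / α ^ i) := by
    rw [MulAction.mem_stabilizer_iff, AlgEquiv.smul_def, map_div₀, map_pow, σ_α,
      ← div_mul_cancel₀ (σ γ) hγ0, ← σ_γ, mul_pow, mul_div_mul_left]
    exact pow_ne_zero i ((_root_.map_ne_zero _).2 (hω.ne_zero (NeZero.ne n)))
  have fixed (τ : Gal(L/K)) : τ (γ / α ^ i) = γ / α ^ i := by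
    obtain ⟨k, rfl⟩ := e.surjective τ
    have k_eq : k = Multiplicative.ofAdd 1 ^ k.toAdd.val := by
      rw [← ofAdd_nsmul, nsmul_one, ZMod.natCast_zmod_val, ofAdd_toAdd]
    rw [k_eq, map_pow]
    exact pow_mem σ_fix _
  obtain ⟨f, hf⟩ := (IsGalois.mem_range_algebraMap_iff_fixed (γ / α ^ i)).2 fixed
  exact ⟨i, hi, f, by rw [hf, div_mul_cancel₀ γ (pow_ne_zero i hα0)]⟩

variable {F E : Type*} [Field F] [Field E] [Algebra F E]

theorem adjoin_insert_of_mem {S : Set E} {z : E} (hz : z ∈ adjoin F S) :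
    adjoin F (insert z S) = adjoin F S :=
  le_antisymm (adjoin_le_iff.2 (Set.insert_subset hz (subset_adjoin F S)))
    (adjoin.mono F S _ (Set.subset_insert z S))

theorem restrictScalars_adjoin_simple_adjoin (S : Set E) (z : E) :
    (adjoin (adjoin F S) {z}).restrictScalars F = adjoin F (insert z S) := by
  rw [adjoin_adjoin_left, Set.union_singleton]

variable {p : ℕ} (hp : p.Prime) {z ω : E} (hω : IsPrimitiveRoot ω p)
include hp hω

theorem irreducible_X_pow_sub_C_of_notMem {M : IntermediateField F E} (hωM : ω ∈ M)
    (hz : z ^ p ∈ M) (hzM : z ∉ M) :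
    Irreducible (X ^ p - C (⟨z ^ p, hz⟩ : M)) :=
  have : NeZero p := ⟨hp.ne_zero⟩
  X_pow_sub_C_irreducible_of_prime hp fun b hb =>
    hzM (mem_of_pow_eq_pow hω hωM b.2 (congrArg Subtype.val hb).symm)

theorem finrank_adjoin_simple_of_notMem {M : IntermediateField F E} (hωM : ω ∈ M)
    (hz : z ^ p ∈ M) (hzM : z ∉ M) : finrank M (adjoin M {z}) = p := by
  have irreducible := irreducible_X_pow_sub_C_of_notMem hp hω hωM hz hzM
  have minpoly_eq : minpoly M z = X ^ p - C ⟨z ^ p, hz⟩ :=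
    (minpoly.eq_of_irreducible_of_monic irreducible
      (by simp [IntermediateField.algebraMap_apply]) (monic_X_pow_sub_C _ hp.ne_zero)).symm
  have integral : IsIntegral M z := minpoly.ne_zero_iff.1 (minpoly_eq ▸ irreducible.ne_zero)
  rw [adjoin.finrank integral, minpoly_eq, natDegree_X_pow_sub_C]

variable {S : Set E} (hωS : ω ∈ adjoin F S) (hz : z ^ p ∈ adjoin F S) (hzS : z ∉ adjoin F S)
include hωS hz hzS

theorem finrank_adjoin_insert_of_notMem :
    finrank F (adjoin F (insert z S)) = finrank F (adjoin F S) * p := by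
  rw [← restrictScalars_adjoin_simple_adjoin]
  have tower := finrank_mul_finrank F (adjoin F S) (adjoin (adjoin F S) {z})
  rw [finrank_adjoin_simple_of_notMem hp hω hωS hz hzS] at tower
  exact tower.symm

theorem exists_eq_mul_pow_of_mem_adjoin_insert {γ : E} (hγ : γ ∈ adjoin F (insert z S))
    (hγp : γ ^ p ∈ adjoin F S) : ∃ i < p, ∃ f ∈ adjoin F S, γ = f * z ^ i := by
  rw [← restrictScalars_adjoin_simple_adjoin, mem_restrictScalars] at hγ
  let M := adjoin F S
  have finrank_eq := finrank_adjoin_simple_of_notMem hp hω hωS hz hzS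
  have : NeZero p := ⟨hp.ne_zero⟩
  have : FiniteDimensional M (adjoin M {z}) := .of_finrank_pos (finrank_eq ▸ hp.pos)
  have hω' : IsPrimitiveRoot (⟨ω, hωS⟩ : M) p :=
    hω.of_map_of_injective (f := algebraMap M E) (algebraMap M E).injective
  have z_ne : z ≠ 0 := fun h => hzS (h ▸ zero_mem M)
  have gen_ne : AdjoinSimple.gen M z ≠ 0 := fun h => z_ne (congrArg Subtype.val h)
  have hα : AdjoinSimple.gen M z ^ finrank M (adjoin M {z}) = algebraMap M _ ⟨z ^ p, hz⟩ := by
    rw [finrank_eq]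
    exact Subtype.ext rfl
  have splitting := isSplittingField_X_pow_sub_C_of_root_adjoin_eq_top
    (by rw [finrank_eq]; exact ⟨_, (mem_primitiveRoots hp.pos).2 hω'⟩) hα <| by
      apply lift_injective
      rw [lift_adjoin_simple, AdjoinSimple.coe_gen, lift_top]
  rw [finrank_eq] at splitting hα
  obtain ⟨i, hi, f, hf⟩ := exists_eq_algebraMap_mul_pow_of_pow_eq (L := adjoin M {z})
    (γ := ⟨γ, hγ⟩) (g := ⟨γ ^ p, hγp⟩) hω' (irreducible_X_pow_sub_C_of_notMem hp hω hωS hz hzS)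
    (α := AdjoinSimple.gen M z) gen_ne hα (Subtype.ext rfl)
  exact ⟨i, hi, f, f.2, congrArg Subtype.val hf⟩

end Kummer

section Degrees

open Module
open IntermediateField hiding algebraMap_mem

theorem exists_eq_pow_of_coprime_finrank {K M : Type*} [Field K] [Field M] [Algebra K M] {n : ℕ}
    (hn : (finrank K M).Coprime n) {q : K} {f : M} (hf : f ^ n = algebraMap K M q) :
    ∃ t : K, q = t ^ n := by
  have norm_eq : Algebra.norm K f ^ n = q ^ finrank K M := by
    rw [← map_pow, hf, Algebra.norm_algebraMap]
  obtain ⟨t, ht⟩ := (pow_mem_range_pow_of_coprime hn q).1 ⟨_, norm_eq⟩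
  exact ⟨t, ht.symm⟩

theorem three_ne_rat_cube (t : ℚ) : t ^ 3 ≠ 3 := by
  intro h
  have valuation := congrArg (padicValRat 3) h
  have self_eq : padicValRat 3 3 = 1 := mod_cast padicValRat.self (p := 3) (by norm_num)
  rw [padicValRat.pow, self_eq] at valuation
  omega

/-- `q` is `1` or `-3` times a square, i.e. a square in `ℚ(√-3)`. -/
def IsSquareUpToNegThree (q : ℚ) : Prop :=
  ∃ t : ℚ, q = t ^ 2 ∨ q = -3 * t ^ 2

/-- `q` is `1`, `3` or `9` times a cube, i.e. a cube in `ℚ(∛3)`. -/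
def IsCubeUpToThree (q : ℚ) : Prop :=
  ∃ t : ℚ, q = t ^ 3 ∨ q = 3 * t ^ 3 ∨ q = 9 * t ^ 3

variable {L : Type*} [Field L] [CharZero L]

theorem exists_eq_cube_of_mem {M : IntermediateField ℚ L} (hM : (finrank ℚ M).Coprime 3) {q : ℚ}
    {γ : L} (hγ : γ ∈ M) (hγq : γ ^ 3 = algebraMap ℚ L q) : ∃ t : ℚ, q = t ^ 3 :=
  exists_eq_pow_of_coprime_finrank hM (f := (⟨γ, hγ⟩ : M)) (Subtype.ext hγq)

theorem notMem_bot_of_sq_eq_neg_three {w : L} (hw : w ^ 2 = -3) :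
    w ∉ (⊥ : IntermediateField ℚ L) := by
  rintro ⟨q, rfl⟩
  have : q ^ 2 = -3 := (algebraMap ℚ L).injective (by simpa using hw)
  nlinarith [sq_nonneg q]

theorem finrank_adjoin_sqrt_neg_three {w : L} (hw : w ^ 2 = -3) :
    finrank ℚ (adjoin ℚ {w}) = 2 := by
  have finrank_eq := finrank_adjoin_insert_of_notMem (F := ℚ) (S := ∅) Nat.prime_two
    (IsPrimitiveRoot.neg_one (R := L) 0 two_ne_zero.symm) (neg_mem (one_mem _))
    (hw ▸ neg_mem (ofNat_mem _ 3)) (by rw [adjoin_empty]; exact notMem_bot_of_sq_eq_neg_three hw)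
  rwa [insert_empty_eq, adjoin_empty, IntermediateField.finrank_bot, one_mul] at finrank_eq

theorem mem_adjoin_sqrt_neg_three_iff {w r : L} {d : ℚ} (hw : w ^ 2 = -3)
    (hr : r ^ 2 = algebraMap ℚ L d) : r ∈ adjoin ℚ {w} ↔ IsSquareUpToNegThree d := by
  have hwM := mem_adjoin_simple_self ℚ w
  constructor
  · intro hrM
    rw [← insert_empty_eq w] at hrM
    obtain ⟨i, hi, f, hf, rfl⟩ := exists_eq_mul_pow_of_mem_adjoin_insert Nat.prime_two
      (IsPrimitiveRoot.neg_one (R := L) 0 two_ne_zero.symm) (neg_mem (one_mem _))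
      (hw ▸ neg_mem (ofNat_mem _ 3))
      (by rw [adjoin_empty]; exact notMem_bot_of_sq_eq_neg_three hw) hrM
      (hr ▸ algebraMap_mem _ d)
    rw [adjoin_empty] at hf
    obtain ⟨t, rfl⟩ := hf
    refine ⟨t, ?_⟩
    interval_cases i
    · exact .inl ((algebraMap ℚ L).injective (by simpa using hr.symm))
    · exact .inr ((algebraMap ℚ L).injective (by simpa [mul_pow, hw, mul_comm] using hr.symm))
  · rintro ⟨t, rfl | rfl⟩
    · exact mem_of_sq_eq_sq (algebraMap_mem _ t) (by rw [hr, map_pow])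
    · refine mem_of_sq_eq_sq (mul_mem hwM (algebraMap_mem _ t)) ?_
      rw [hr, mul_pow, hw, map_mul, map_pow, map_neg, map_ofNat]

open scoped Classical in
theorem finrank_adjoin_sqrt_sqrt_neg_three {w r : L} {d : ℚ} (hw : w ^ 2 = -3)
    (hr : r ^ 2 = algebraMap ℚ L d) :
    finrank ℚ (adjoin ℚ {r, w}) = if IsSquareUpToNegThree d then 2 else 4 := by
  split_ifs with h <;> rw [← mem_adjoin_sqrt_neg_three_iff hw hr] at h
  · rw [adjoin_insert_of_mem h, finrank_adjoin_sqrt_neg_three hw]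
  · rw [finrank_adjoin_insert_of_notMem Nat.prime_two
      (IsPrimitiveRoot.neg_one (R := L) 0 two_ne_zero.symm) (neg_mem (one_mem _))
      (hr ▸ algebraMap_mem _ d) h, finrank_adjoin_sqrt_neg_three hw]

theorem coprime_finrank_adjoin_sqrt_sqrt_neg_three {w r : L} {d : ℚ} (hw : w ^ 2 = -3)
    (hr : r ^ 2 = algebraMap ℚ L d) : (finrank ℚ (adjoin ℚ {r, w})).Coprime 3 := by
  classical
  rw [finrank_adjoin_sqrt_sqrt_neg_three hw hr]
  split_ifs <;> norm_num

theorem finrank_adjoin_ninth_root {ζ : L} (hζ : IsPrimitiveRoot ζ 9) :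
    finrank ℚ (adjoin ℚ {ζ}) = 6 := by
  rw [adjoin.finrank (hζ.isIntegral (by norm_num)).tower_top,
    ← Polynomial.cyclotomic_eq_minpoly_rat hζ (by norm_num), Polynomial.natDegree_cyclotomic]
  rfl

section CoprimeToThree

variable {S : Set L} (hS : (finrank ℚ (adjoin ℚ S)).Coprime 3)
include hS

open scoped Classical in
theorem finrank_adjoin_insert_cube_root {ω s : L} {d : ℚ} (hω : IsPrimitiveRoot ω 3)
    (hωS : ω ∈ adjoin ℚ S) (hs : s ^ 3 = algebraMap ℚ L d) :
    finrank ℚ (adjoin ℚ (insert s S)) =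
      finrank ℚ (adjoin ℚ S) * if ∃ t, d = t ^ 3 then 1 else 3 := by
  split_ifs with hd
  · obtain ⟨t, rfl⟩ := hd
    rw [adjoin_insert_of_mem (mem_of_pow_eq_pow hω hωS (algebraMap_mem _ t)
      (hs.trans (map_pow _ _ _))), mul_one]
  · exact finrank_adjoin_insert_of_notMem Nat.prime_three hω hωS (hs ▸ algebraMap_mem _ d)
      fun h => hd (exists_eq_cube_of_mem hS h hs)

variable {ζ : L} (hζ : IsPrimitiveRoot ζ 9)
include hζ

theorem ninth_root_notMem : ζ ∉ adjoin ℚ S := by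
  intro h
  have dvd := finrank_dvd_of_le_right (adjoin_simple_le_iff.2 h)
  rw [finrank_adjoin_ninth_root hζ] at dvd
  exact absurd (Nat.Coprime.coprime_dvd_left ((by norm_num : 3 ∣ 6).trans dvd) hS) (by norm_num)

variable (hω : ζ ^ 3 ∈ adjoin ℚ S)
include hω

theorem exists_eq_cube_of_mem_adjoin_insert_ninth_root {γ : L} {q : ℚ}
    (hγ : γ ∈ adjoin ℚ (insert ζ S)) (hγq : γ ^ 3 = algebraMap ℚ L q) : ∃ t : ℚ, q = t ^ 3 := by
  obtain ⟨i, -, f, hf, rfl⟩ := exists_eq_mul_pow_of_mem_adjoin_insert Nat.prime_three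
    (hζ.pow (by norm_num) (by norm_num)) hω hω (ninth_root_notMem hS hζ) hγ
    (hγq ▸ algebraMap_mem _ q)
  -- The factor `ζ ^ i` disappears in the ninth power.
  have ninth_pow : f ^ 9 = algebraMap ℚ L (q ^ 3) := by
    rw [map_pow, ← hγq, ← pow_mul, mul_pow, ← pow_mul, mul_comm i, pow_mul ζ, hζ.pow_eq_one,
      one_pow, mul_one]
  obtain ⟨t, ht⟩ := exists_eq_pow_of_coprime_finrank (hS.pow_right 2) (n := 9)
    (f := (⟨f, hf⟩ : adjoin ℚ S)) (Subtype.ext ninth_pow)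
  exact ⟨t, Odd.pow_injective (n := 3) (by decide) (by simpa [← pow_mul] using ht)⟩

variable {c : L} (hc : c ^ 3 = 3)
include hc

theorem cube_root_three_notMem : c ∉ adjoin ℚ (insert ζ S) := by
  intro h
  obtain ⟨t, ht⟩ := exists_eq_cube_of_mem_adjoin_insert_ninth_root hS hζ hω h (q := 3)
    (by rw [hc, map_ofNat])
  exact three_ne_rat_cube t ht.symm

variable {s : L} {d : ℚ} (hs : s ^ 3 = algebraMap ℚ L d)
include hs

theorem mem_adjoin_cube_root_three_ninth_root_iff :
    s ∈ adjoin ℚ (insert c (insert ζ S)) ↔ IsCubeUpToThree d := by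
  have hω3 : IsPrimitiveRoot (ζ ^ 3) 3 := hζ.pow (by norm_num) (by norm_num)
  have hωM : ζ ^ 3 ∈ adjoin ℚ (insert ζ S) := adjoin.mono _ _ _ (Set.subset_insert _ _) hω
  constructor
  · intro hsM
    obtain ⟨i, hi, f, hf, rfl⟩ := exists_eq_mul_pow_of_mem_adjoin_insert Nat.prime_three
      hω3 hωM (hc ▸ ofNat_mem _ 3) (cube_root_three_notMem hS hζ hω hc) hsM
      (hs ▸ algebraMap_mem _ d)
    have hf3 : f ^ 3 = algebraMap ℚ L (d / 3 ^ i) := by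
      rw [map_div₀, ← hs, map_pow, map_ofNat, ← hc, mul_pow, pow_right_comm, mul_div_cancel_right₀]
      exact pow_ne_zero i (hc ▸ three_ne_zero)
    obtain ⟨t, ht⟩ := exists_eq_cube_of_mem_adjoin_insert_ninth_root hS hζ hω hf hf3
    rw [div_eq_iff (by positivity)] at ht
    refine ⟨t, ?_⟩
    interval_cases i
    · exact .inl (by linarith)
    · exact .inr (.inl (by linarith))
    · exact .inr (.inr (by linarith))
  · have hcM : c ∈ adjoin ℚ (insert c (insert ζ S)) := subset_adjoin _ _ (Set.mem_insert _ _)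
    have mem_of_eq {b : L} (hb : b ∈ adjoin ℚ (insert c (insert ζ S))) (h : s ^ 3 = b ^ 3) :=
      mem_of_pow_eq_pow hω3 (adjoin.mono _ _ _ (Set.subset_insert _ _) hωM) hb h
    rintro ⟨t, rfl | rfl | rfl⟩
    · exact mem_of_eq (algebraMap_mem _ t) (hs.trans (map_pow _ _ _))
    · refine mem_of_eq (mul_mem hcM (algebraMap_mem _ t)) ?_
      rw [hs, mul_pow, hc, map_mul, map_pow, map_ofNat]
    · refine mem_of_eq (mul_mem (pow_mem hcM 2) (algebraMap_mem _ t)) ?_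
      rw [hs, mul_pow, pow_right_comm, hc, map_mul, map_pow, map_ofNat]
      norm_num

open scoped Classical in
theorem finrank_adjoin_insert_cube_roots_ninth_root :
    finrank ℚ (adjoin ℚ (insert s (insert c (insert ζ S)))) =
      finrank ℚ (adjoin ℚ S) * 9 * if IsCubeUpToThree d then 1 else 3 := by
  have hω3 : IsPrimitiveRoot (ζ ^ 3) 3 := hζ.pow (by norm_num) (by norm_num)
  have hωζ : ζ ^ 3 ∈ adjoin ℚ (insert ζ S) := adjoin.mono _ _ _ (Set.subset_insert _ _) hω
  have hωc : ζ ^ 3 ∈ adjoin ℚ (insert c (insert ζ S)) :=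
    adjoin.mono _ _ _ (Set.subset_insert _ _) hωζ
  have finrank_eq : finrank ℚ (adjoin ℚ (insert c (insert ζ S))) = finrank ℚ (adjoin ℚ S) * 9 := by
    rw [finrank_adjoin_insert_of_notMem Nat.prime_three hω3 hωζ (hc ▸ ofNat_mem _ 3)
      (cube_root_three_notMem hS hζ hω hc), finrank_adjoin_insert_of_notMem Nat.prime_three hω3 hω
      hω (ninth_root_notMem hS hζ), mul_assoc, show 3 * 3 = 9 from rfl]
  split_ifs with hd <;> rw [← mem_adjoin_cube_root_three_ninth_root_iff hS hζ hω hc hs] at hd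
  · rw [adjoin_insert_of_mem hd, finrank_eq, mul_one]
  · rw [finrank_adjoin_insert_of_notMem Nat.prime_three hω3 hωc (hs ▸ algebraMap_mem _ d) hd,
      finrank_eq]

end CoprimeToThree

variable [IsAlgClosed L] [DecidableEq L] {d : ℚ} (hd : d ≠ 0)
include hd

open scoped Classical in
theorem finrank_divisionField_three :
    finrank ℚ (divisionField (mordellCurve (16 * d)) 3 L) =
      (if IsSquareUpToNegThree d then 2 else 4) * if ∃ t, d = t ^ 3 then 1 else 3 := by
  obtain ⟨w, hw⟩ := IsAlgClosed.exists_pow_nat_eq (-3 : L) two_pos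
  obtain ⟨r, hr⟩ := IsAlgClosed.exists_pow_nat_eq (algebraMap ℚ L d) two_pos
  obtain ⟨s, hs⟩ := IsAlgClosed.exists_pow_nat_eq (algebraMap ℚ L d) three_pos
  have hwM : w ∈ adjoin ℚ {r, w} := subset_adjoin _ _ (by simp)
  have permute : ({r, w, s} : Set L) = {s, r, w} := by grind
  rw [divisionField_three_eq_adjoin hd hr hs hw, permute, finrank_adjoin_insert_cube_root
    (coprime_finrank_adjoin_sqrt_sqrt_neg_three hw hr)
    (isPrimitiveRoot_three_of_sq_eq_neg_three hw)
    (div_mem (sub_mem hwM (one_mem _)) (ofNat_mem _ 2)) hs,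
    finrank_adjoin_sqrt_sqrt_neg_three hw hr]

open scoped Classical in
theorem finrank_divisionField_nine :
    finrank ℚ (divisionField (mordellCurve (16 * d)) 9 L) =
      (if IsSquareUpToNegThree d then 18 else 36) * if IsCubeUpToThree d then 1 else 3 := by
  obtain ⟨ζ, hζ⟩ := HasEnoughRootsOfUnity.exists_primitiveRoot L 9
  obtain ⟨r, hr⟩ := IsAlgClosed.exists_pow_nat_eq (algebraMap ℚ L d) two_pos
  obtain ⟨s, hs⟩ := IsAlgClosed.exists_pow_nat_eq (algebraMap ℚ L d) three_pos
  obtain ⟨c, hc⟩ := IsAlgClosed.exists_pow_nat_eq (3 : L) three_pos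
  have hw := one_add_two_mul_cube_sq hζ
  have hω : ζ ^ 3 ∈ adjoin ℚ {r, 1 + 2 * ζ ^ 3} :=
    one_add_two_mul_mem_iff.1 (subset_adjoin _ _ (by simp))
  have hwζ : 1 + 2 * ζ ^ 3 ∈ adjoin ℚ {ζ, c, r, s} :=
    one_add_two_mul_mem_iff.2 (pow_mem (subset_adjoin _ _ (by simp)) 3)
  have permute : (insert (1 + 2 * ζ ^ 3) {ζ, c, r, s} : Set L) = {s, c, ζ, r, 1 + 2 * ζ ^ 3} := by
    grind
  rw [divisionField_nine_eq_adjoin hd hr hs hζ hc, ← adjoin_insert_of_mem hwζ, permute,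
    finrank_adjoin_insert_cube_roots_ninth_root
      (coprime_finrank_adjoin_sqrt_sqrt_neg_three hw hr) hζ hω hc hs,
    finrank_adjoin_sqrt_sqrt_neg_three hw hr, ite_mul]

end Degrees

section PowerFree

namespace IsPowerFree

theorem eq_of_eq_mul_pow {k : ℕ} {p q v : ℚ} (hk : Even k) (hp : IsPowerFree k p)
    (hq : IsPowerFree k q) (h : p = q * v ^ k) : p = q := by
  obtain ⟨m, rfl, hm⟩ := hp
  obtain ⟨n, rfl, hn⟩ := hq
  have cross_mul : m * (v.den : ℤ) ^ k = n * v.num ^ k := by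
    rw [← v.num_div_den, div_pow, mul_div_assoc', eq_div_iff (by simp)] at h
    exact_mod_cast h
  have coprime : IsCoprime (v.num ^ k) ((v.den : ℤ) ^ k) := (Rat.isCoprime_num_den v).pow
  have pow_eq_one {u : ℤ} (hu : u = 1 ∨ u = -1) : u ^ k = 1 := by
    rcases hu with rfl | rfl
    exacts [one_pow k, hk.neg_one_pow]
  have num_eq := pow_eq_one (hm _ (coprime.dvd_of_dvd_mul_right (Dvd.intro_left n cross_mul.symm)))
  have den_eq := pow_eq_one (hn _ (coprime.symm.dvd_of_dvd_mul_right (Dvd.intro_left m cross_mul)))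
  rw [num_eq, den_eq, mul_one, mul_one] at cross_mul
  rw [cross_mul]

theorem eq_of_eq_mul_pow_of_eq_mul_pow {i j : ℕ} {p q a b x x₀ y y₀ : ℚ} (hij : i.Coprime j)
    (heven : Even (i * j)) (hp : IsPowerFree (i * j) p) (hq : IsPowerFree (i * j) q) (hq0 : q ≠ 0)
    (hpx : p = a * x ^ i) (hpy : p = b * y ^ j) (hqx : q = a * x₀ ^ i) (hqy : q = b * y₀ ^ j) :
    p = q := by
  have ratio_x : p / q = (x / x₀) ^ i := by
    rw [hpx, hqx, mul_div_mul_left _ _ (left_ne_zero_of_mul (hqx ▸ hq0)), div_pow]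
  have ratio_y : p / q = (y / y₀) ^ j := by
    rw [hpy, hqy, mul_div_mul_left _ _ (left_ne_zero_of_mul (hqy ▸ hq0)), div_pow]
  obtain ⟨v, hv, -⟩ := (pow_eq_pow_iff_of_coprime hij).1 (ratio_x.symm.trans ratio_y)
  refine eq_of_eq_mul_pow heven hp hq (v := v) ?_
  rw [mul_comm i, pow_mul, ← hv, ← ratio_x, mul_div_cancel₀ _ hq0]

end IsPowerFree

theorem isPowerFree_six_sixteen_mul {n : ℤ} (hn : n ∣ 243) : IsPowerFree 6 (16 * n) := by
  refine ⟨16 * n, by push_cast; rfl, fun m hm => ?_⟩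
  have m_dvd : m ^ 6 ∣ 3888 := hm.trans (mul_dvd_mul_left 16 hn)
  have m_lt : |m| < 4 := by
    refine lt_of_pow_lt_pow_left₀ 6 (by norm_num) ?_
    rw [← abs_pow]
    exact (Int.le_of_dvd (by norm_num) ((abs_dvd _ _).2 m_dvd)).trans_lt (by norm_num)
  obtain ⟨lower, upper⟩ := abs_lt.1 m_lt
  interval_cases m <;> revert m_dvd <;> decide

end PowerFree

section Classification

variable {d : ℚ} (hfree : IsPowerFree 6 (16 * d))
include hfree

theorem eq_intCast_of_eq_mul_sq_of_eq_mul_cube {a b x x₀ t t₀ : ℚ} {n : ℤ} (hn : n ∣ 243)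
    (hdx : d = a * x ^ 2) (hdt : d = b * t ^ 3) (hnx : n = a * x₀ ^ 2) (hnt : n = b * t₀ ^ 3) :
    d = n := by
  have n_ne : (n : ℚ) ≠ 0 := Int.cast_ne_zero.2 (ne_zero_of_dvd_ne_zero (by norm_num) hn)
  have eq := IsPowerFree.eq_of_eq_mul_pow_of_eq_mul_pow (i := 2) (j := 3) (by norm_num)
    (by decide) hfree (isPowerFree_six_sixteen_mul hn) (mul_ne_zero (by norm_num) n_ne)
    (a := 16 * a) (b := 16 * b) (by rw [mul_assoc, ← hdx]) (by rw [mul_assoc, ← hdt])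
    (by rw [mul_assoc, ← hnx]) (by rw [mul_assoc, ← hnt])
  linarith

section Intersection

variable {a b x₀ t₀ : ℚ} (n : ℤ) (hn : n ∣ 243) (hnx : n = a * x₀ ^ 2) (hnt : n = b * t₀ ^ 3)
include hn hnx hnt

theorem exists_eq_mul_sq_iff {t : ℚ} (hdt : d = b * t ^ 3) : (∃ x, d = a * x ^ 2) ↔ t = t₀ := by
  constructor
  · rintro ⟨x, hdx⟩
    have n_ne : (n : ℚ) ≠ 0 := Int.cast_ne_zero.2 (ne_zero_of_dvd_ne_zero (by norm_num) hn)
    have eq := eq_intCast_of_eq_mul_sq_of_eq_mul_cube hfree hn hdx hdt hnx hnt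
    rw [hdt, hnt, mul_right_inj' (left_ne_zero_of_mul (hnt ▸ n_ne))] at eq
    exact Odd.pow_injective (by decide) eq
  · rintro rfl
    exact ⟨x₀, by rw [hdt, ← hnt, hnx]⟩

theorem exists_eq_mul_cube_iff {x : ℚ} (hdx : d = a * x ^ 2) :
    (∃ t, d = b * t ^ 3) ↔ x = x₀ ∨ x = -x₀ := by
  constructor
  · rintro ⟨t, hdt⟩
    have n_ne : (n : ℚ) ≠ 0 := Int.cast_ne_zero.2 (ne_zero_of_dvd_ne_zero (by norm_num) hn)
    have eq := eq_intCast_of_eq_mul_sq_of_eq_mul_cube hfree hn hdx hdt hnx hnt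
    rw [hdx, hnx, mul_right_inj' (left_ne_zero_of_mul (hnx ▸ n_ne))] at eq
    exact sq_eq_sq_iff_eq_or_eq_neg.1 eq
  · rintro (rfl | rfl)
    · exact ⟨t₀, by rw [hdx, ← hnx, hnt]⟩
    · exact ⟨t₀, by rw [hdx, neg_sq, ← hnx, hnt]⟩

end Intersection

theorem isSquareUpToNegThree_iff_of_eq_cube {t : ℚ} (ht : d = t ^ 3) :
    IsSquareUpToNegThree d ↔ t = 1 ∨ t = -3 := by
  rw [← one_mul (t ^ 3)] at ht
  simpa only [IsSquareUpToNegThree, exists_or, one_mul] using or_congr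
    (exists_eq_mul_sq_iff hfree (a := 1) (x₀ := 1) (t₀ := 1) 1
      (by norm_num) (by norm_num) (by norm_num) ht)
    (exists_eq_mul_sq_iff hfree (a := -3) (x₀ := 3) (t₀ := -3) (-27)
      (by norm_num) (by norm_num) (by norm_num) ht)

theorem isSquareUpToNegThree_iff_of_eq_three_mul_cube {t : ℚ} (ht : d = 3 * t ^ 3) :
    IsSquareUpToNegThree d ↔ t = 3 ∨ t = -1 := by
  simpa only [IsSquareUpToNegThree, exists_or, one_mul] using or_congr
    (exists_eq_mul_sq_iff hfree (a := 1) (x₀ := 9) (t₀ := 3) 81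
      (by norm_num) (by norm_num) (by norm_num) ht)
    (exists_eq_mul_sq_iff hfree (a := -3) (x₀ := 1) (t₀ := -1) (-3)
      (by norm_num) (by norm_num) (by norm_num) ht)

theorem isSquareUpToNegThree_iff_of_eq_nine_mul_cube {t : ℚ} (ht : d = 9 * t ^ 3) :
    IsSquareUpToNegThree d ↔ t = 1 ∨ t = -3 := by
  simpa only [IsSquareUpToNegThree, exists_or, one_mul] using or_congr
    (exists_eq_mul_sq_iff hfree (a := 1) (x₀ := 3) (t₀ := 1) 9
      (by norm_num) (by norm_num) (by norm_num) ht)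
    (exists_eq_mul_sq_iff hfree (a := -3) (x₀ := 9) (t₀ := -3) (-243)
      (by norm_num) (by norm_num) (by norm_num) ht)

theorem exists_eq_cube_iff_of_eq_sq {x : ℚ} (hx : d = x ^ 2) :
    (∃ t, d = t ^ 3) ↔ x = 1 ∨ x = -1 := by
  simpa only [one_mul] using exists_eq_mul_cube_iff hfree (a := 1) (b := 1) (x₀ := 1) (t₀ := 1) 1
    (by norm_num) (by norm_num) (by norm_num) (by rwa [one_mul])

theorem exists_eq_cube_iff_of_eq_neg_three_mul_sq {x : ℚ} (hx : d = -3 * x ^ 2) :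
    (∃ t, d = t ^ 3) ↔ x = 3 ∨ x = -3 := by
  simpa only [one_mul] using exists_eq_mul_cube_iff hfree (b := 1) (x₀ := 3) (t₀ := -3) (-27)
    (by norm_num) (by norm_num) (by norm_num) hx

theorem isCubeUpToThree_iff_of_eq_sq {x : ℚ} (hx : d = x ^ 2) :
    IsCubeUpToThree d ↔ (x = 1 ∨ x = -1) ∨ (x = 9 ∨ x = -9) ∨ (x = 3 ∨ x = -3) := by
  rw [IsCubeUpToThree, exists_or, exists_or, exists_eq_cube_iff_of_eq_sq hfree hx]
  rw [← one_mul (x ^ 2)] at hx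
  refine or_congr_right (or_congr ?_ ?_)
  · exact exists_eq_mul_cube_iff hfree (t₀ := 3) 81
      (by norm_num) (by norm_num) (by norm_num) hx
  · exact exists_eq_mul_cube_iff hfree (t₀ := 1) 9
      (by norm_num) (by norm_num) (by norm_num) hx

theorem isCubeUpToThree_iff_of_eq_neg_three_mul_sq {x : ℚ} (hx : d = -3 * x ^ 2) :
    IsCubeUpToThree d ↔ (x = 3 ∨ x = -3) ∨ (x = 1 ∨ x = -1) ∨ (x = 9 ∨ x = -9) := by
  rw [IsCubeUpToThree, exists_or, exists_or, exists_eq_cube_iff_of_eq_neg_three_mul_sq hfree hx]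
  refine or_congr_right (or_congr ?_ ?_)
  · exact exists_eq_mul_cube_iff hfree (t₀ := -1) (-3)
      (by norm_num) (by norm_num) (by norm_num) hx
  · exact exists_eq_mul_cube_iff hfree (t₀ := -3) (-243)
      (by norm_num) (by norm_num) (by norm_num) hx

theorem isSquareUpToNegThree_and_cube_iff :
    (IsSquareUpToNegThree d ∧ ∃ t, d = t ^ 3) ↔ d = 1 ∨ d = -27 := by
  constructor
  · rintro ⟨hS, t, ht⟩
    rcases (isSquareUpToNegThree_iff_of_eq_cube hfree ht).1 hS with rfl | rfl <;> norm_num [ht]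
  · rintro (rfl | rfl)
    · exact ⟨⟨1, by norm_num⟩, 1, by norm_num⟩
    · exact ⟨⟨3, by norm_num⟩, -3, by norm_num⟩

theorem isSquareUpToNegThree_and_isCubeUpToThree_iff :
    IsSquareUpToNegThree d ∧ IsCubeUpToThree d ↔
      d = 1 ∨ d = -3 ∨ d = 9 ∨ d = -27 ∨ d = 81 ∨ d = -243 := by
  constructor
  · rintro ⟨hS, t, ht | ht | ht⟩
    · rcases (isSquareUpToNegThree_iff_of_eq_cube hfree ht).1 hS with rfl | rfl <;> norm_num [ht]
    · rcases (isSquareUpToNegThree_iff_of_eq_three_mul_cube hfree ht).1 hS with rfl | rfl <;>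
        norm_num [ht]
    · rcases (isSquareUpToNegThree_iff_of_eq_nine_mul_cube hfree ht).1 hS with rfl | rfl <;>
        norm_num [ht]
  · rintro (rfl | rfl | rfl | rfl | rfl | rfl)
    · exact ⟨⟨1, by norm_num⟩, 1, by norm_num⟩
    · exact ⟨⟨1, by norm_num⟩, -1, by norm_num⟩
    · exact ⟨⟨3, by norm_num⟩, 1, by norm_num⟩
    · exact ⟨⟨3, by norm_num⟩, -3, by norm_num⟩
    · exact ⟨⟨9, by norm_num⟩, 3, by norm_num⟩
    · exact ⟨⟨9, by norm_num⟩, -3, by norm_num⟩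

variable (hd : d ≠ 0)
include hd

theorem not_isSquareUpToNegThree_and_cube_iff :
    (¬ IsSquareUpToNegThree d ∧ ∃ t, d = t ^ 3) ↔
      ∃ t : ℚ, t ≠ 0 ∧ t ≠ 1 ∧ t ≠ -3 ∧ d = t ^ 3 := by
  rw [← exists_and_left]
  refine exists_congr fun t => ?_
  constructor
  · rintro ⟨hS, rfl⟩
    rw [isSquareUpToNegThree_iff_of_eq_cube hfree rfl, not_or] at hS
    exact ⟨ne_zero_pow three_ne_zero hd, hS.1, hS.2, rfl⟩
  · rintro ⟨-, h1, h3, rfl⟩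
    rw [isSquareUpToNegThree_iff_of_eq_cube hfree rfl, not_or]
    exact ⟨⟨h1, h3⟩, rfl⟩

theorem isSquareUpToNegThree_and_not_cube_iff :
    (IsSquareUpToNegThree d ∧ ¬ ∃ t, d = t ^ 3) ↔
      (∃ x : ℚ, x ≠ 0 ∧ x ≠ 1 ∧ x ≠ -1 ∧ d = x ^ 2) ∨
        ∃ x : ℚ, x ≠ 0 ∧ x ≠ 3 ∧ x ≠ -3 ∧ d = -3 * x ^ 2 := by
  constructor
  · rintro ⟨⟨x, rfl | rfl⟩, hC⟩
    · rw [exists_eq_cube_iff_of_eq_sq hfree rfl, not_or] at hC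
      exact .inl ⟨x, ne_zero_pow two_ne_zero hd, hC.1, hC.2, rfl⟩
    · rw [exists_eq_cube_iff_of_eq_neg_three_mul_sq hfree rfl, not_or] at hC
      exact .inr ⟨x, ne_zero_pow two_ne_zero (right_ne_zero_of_mul hd), hC.1, hC.2, rfl⟩
  · rintro (⟨x, -, h1, h2, rfl⟩ | ⟨x, -, h1, h2, rfl⟩)
    · rw [exists_eq_cube_iff_of_eq_sq hfree rfl, not_or]
      exact ⟨⟨x, .inl rfl⟩, h1, h2⟩
    · rw [exists_eq_cube_iff_of_eq_neg_three_mul_sq hfree rfl, not_or]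
      exact ⟨⟨x, .inr rfl⟩, h1, h2⟩

theorem not_isSquareUpToNegThree_and_isCubeUpToThree_iff :
    ¬ IsSquareUpToNegThree d ∧ IsCubeUpToThree d ↔
      (∃ t : ℚ, t ≠ 0 ∧ t ≠ 1 ∧ t ≠ -3 ∧ (d = t ^ 3 ∨ d = 9 * t ^ 3)) ∨
        ∃ t : ℚ, t ≠ 0 ∧ t ≠ -1 ∧ t ≠ 3 ∧ d = 3 * t ^ 3 := by
  constructor
  · rintro ⟨hS, t, ht⟩
    have t_ne : t ≠ 0 := by
      rintro rfl
      exact hd (by simpa using ht)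
    rcases ht with ht | ht | ht
    · rw [isSquareUpToNegThree_iff_of_eq_cube hfree ht, not_or] at hS
      exact .inl ⟨t, t_ne, hS.1, hS.2, .inl ht⟩
    · rw [isSquareUpToNegThree_iff_of_eq_three_mul_cube hfree ht, not_or] at hS
      exact .inr ⟨t, t_ne, hS.2, hS.1, ht⟩
    · rw [isSquareUpToNegThree_iff_of_eq_nine_mul_cube hfree ht, not_or] at hS
      exact .inl ⟨t, t_ne, hS.1, hS.2, .inr ht⟩
  · rintro (⟨t, -, h1, h3, ht | ht⟩ | ⟨t, -, h1, h3, ht⟩)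
    · rw [isSquareUpToNegThree_iff_of_eq_cube hfree ht, not_or]
      exact ⟨⟨h1, h3⟩, t, .inl ht⟩
    · rw [isSquareUpToNegThree_iff_of_eq_nine_mul_cube hfree ht, not_or]
      exact ⟨⟨h1, h3⟩, t, .inr (.inr ht)⟩
    · rw [isSquareUpToNegThree_iff_of_eq_three_mul_cube hfree ht, not_or]
      exact ⟨⟨h3, h1⟩, t, .inr (.inl ht)⟩

theorem isSquareUpToNegThree_and_not_isCubeUpToThree_iff :
    IsSquareUpToNegThree d ∧ ¬ IsCubeUpToThree d ↔
      ∃ x : ℚ, x ≠ 0 ∧ x ≠ 1 ∧ x ≠ -1 ∧ x ≠ 3 ∧ x ≠ -3 ∧ x ≠ 9 ∧ x ≠ -9 ∧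
        (d = x ^ 2 ∨ d = -3 * x ^ 2) := by
  rw [IsSquareUpToNegThree, ← exists_and_right]
  refine exists_congr fun x => ?_
  have x_ne (h : d = x ^ 2 ∨ d = -3 * x ^ 2) : x ≠ 0 := by
    rintro rfl
    exact hd (by simpa using h)
  have isCube_iff (h : d = x ^ 2 ∨ d = -3 * x ^ 2) : IsCubeUpToThree d ↔
      x = 1 ∨ x = -1 ∨ x = 3 ∨ x = -3 ∨ x = 9 ∨ x = -9 := by
    rcases h with h | h
    · rw [isCubeUpToThree_iff_of_eq_sq hfree h]
      tauto
    · rw [isCubeUpToThree_iff_of_eq_neg_three_mul_sq hfree h]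
      tauto
  tauto

end Classification

theorem ite_mul_ite_eq_iff {S C P₁ P₂ P₃ : Prop} [Decidable S] [Decidable C] {n : ℕ} (hn : n ≠ 0)
    (h₁ : S ∧ C ↔ P₁) (h₂ : ¬ S ∧ C ↔ P₂) (h₃ : S ∧ ¬ C ↔ P₃) :
    ((if S then n else 2 * n) * (if C then 1 else 3) = n ↔ P₁) ∧
      ((if S then n else 2 * n) * (if C then 1 else 3) = 2 * n ↔ P₂) ∧
      ((if S then n else 2 * n) * (if C then 1 else 3) = 3 * n ↔ P₃) ∧
      ((if S then n else 2 * n) * (if C then 1 else 3) = 6 * n ↔ ¬ (P₁ ∨ P₂ ∨ P₃)) := by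
  rw [← h₁, ← h₂, ← h₃]
  by_cases hS : S <;> by_cases hC : C <;> simp only [hS, hC, if_true, if_false] <;> grind

theorem mainTheorem9 (d : ℚ) (hd : d ≠ 0) (hfree : IsPowerFree 6 (16 * d)) :
    -- the division fields, whichever complex square and cube roots are chosen
    (∀ w r s c : ℂ, w ^ 2 = -3 → r ^ 2 = (d : ℂ) → s ^ 3 = (d : ℂ) → c ^ 3 = 3 →
      divisionField (curveE d) 3 ℂ = IntermediateField.adjoin ℚ {r, w, s} ∧
      divisionField (curveE d) 9 ℂ =
        IntermediateField.adjoin ℚ {w, c, r, s, ((Real.cos (2 * Real.pi / 9) : ℝ) : ℂ)}) ∧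
    -- the degree of the 3-division field
    ((Module.finrank ℚ (divisionField (curveE d) 3 ℂ) = 2 ↔ d = 1 ∨ d = -27) ∧
      (Module.finrank ℚ (divisionField (curveE d) 3 ℂ) = 4 ↔
        ∃ t : ℚ, t ≠ 0 ∧ t ≠ 1 ∧ t ≠ -3 ∧ d = t ^ 3) ∧
      (Module.finrank ℚ (divisionField (curveE d) 3 ℂ) = 6 ↔
        (∃ t : ℚ, t ≠ 0 ∧ t ≠ 1 ∧ t ≠ -1 ∧ d = t ^ 2) ∨
        (∃ t : ℚ, t ≠ 0 ∧ t ≠ 3 ∧ t ≠ -3 ∧ d = -3 * t ^ 2)) ∧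
      (Module.finrank ℚ (divisionField (curveE d) 3 ℂ) = 12 ↔
        ¬ ((d = 1 ∨ d = -27) ∨
          (∃ t : ℚ, t ≠ 0 ∧ t ≠ 1 ∧ t ≠ -3 ∧ d = t ^ 3) ∨
          (∃ t : ℚ, t ≠ 0 ∧ t ≠ 1 ∧ t ≠ -1 ∧ d = t ^ 2) ∨
          (∃ t : ℚ, t ≠ 0 ∧ t ≠ 3 ∧ t ≠ -3 ∧ d = -3 * t ^ 2)))) ∧
    -- the degree of the 9-division field
    ((Module.finrank ℚ (divisionField (curveE d) 9 ℂ) = 18 ↔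
        d = 1 ∨ d = -3 ∨ d = 9 ∨ d = -27 ∨ d = 81 ∨ d = -243) ∧
      (Module.finrank ℚ (divisionField (curveE d) 9 ℂ) = 36 ↔
        (∃ t : ℚ, t ≠ 0 ∧ t ≠ 1 ∧ t ≠ -3 ∧ (d = t ^ 3 ∨ d = 9 * t ^ 3)) ∨
        (∃ t : ℚ, t ≠ 0 ∧ t ≠ -1 ∧ t ≠ 3 ∧ d = 3 * t ^ 3)) ∧
      (Module.finrank ℚ (divisionField (curveE d) 9 ℂ) = 54 ↔
        ∃ t : ℚ, t ≠ 0 ∧ t ≠ 1 ∧ t ≠ -1 ∧ t ≠ 3 ∧ t ≠ -3 ∧ t ≠ 9 ∧ t ≠ -9 ∧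
          (d = t ^ 2 ∨ d = -3 * t ^ 2)) ∧
      (Module.finrank ℚ (divisionField (curveE d) 9 ℂ) = 108 ↔
        ¬ ((d = 1 ∨ d = -3 ∨ d = 9 ∨ d = -27 ∨ d = 81 ∨ d = -243) ∨
          (∃ t : ℚ, t ≠ 0 ∧ t ≠ 1 ∧ t ≠ -3 ∧ (d = t ^ 3 ∨ d = 9 * t ^ 3)) ∨
          (∃ t : ℚ, t ≠ 0 ∧ t ≠ -1 ∧ t ≠ 3 ∧ d = 3 * t ^ 3) ∨
          (∃ t : ℚ, t ≠ 0 ∧ t ≠ 1 ∧ t ≠ -1 ∧ t ≠ 3 ∧ t ≠ -3 ∧ t ≠ 9 ∧ t ≠ -9 ∧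
            (d = t ^ 2 ∨ d = -3 * t ^ 2))))) := by
  classical
  rw [show curveE d = mordellCurve (16 * d) from rfl]
  refine ⟨fun w r s c hw hr hs hc => ⟨divisionField_three_eq_adjoin hd hr hs hw,
    divisionField_nine_eq_adjoin_sqrt_neg_three_cos hd hr hs hw hc
      (Complex.isPrimitiveRoot_exp 9 (by norm_num)) two_mul_cos_eq_exp_add_inv⟩, ?_, ?_⟩
  · rw [finrank_divisionField_three hd]
    exact ite_mul_ite_eq_iff two_ne_zero (isSquareUpToNegThree_and_cube_iff hfree)
      (not_isSquareUpToNegThree_and_cube_iff hfree hd)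
      (isSquareUpToNegThree_and_not_cube_iff hfree hd)
  · rw [finrank_divisionField_nine hd]
    simpa only [or_assoc] using ite_mul_ite_eq_iff (n := 18) (by norm_num)
      (isSquareUpToNegThree_and_isCubeUpToThree_iff hfree)
      (not_isSquareUpToNegThree_and_isCubeUpToThree_iff hfree hd)
      (isSquareUpToNegThree_and_not_isCubeUpToThree_iff hfree hd)
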